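/- Let $(M,g)$ be a smooth four-dimensional spacetime of signature $(-,+,+,+)$ satisfying the vacuum Einstein equations $R_{\mu\nu}-\tfrac12 R g_{\mu\nu}+\Lambda g_{\mu\nu}=0$ for some constant $\Lambda\in\mathbb R$ (possibly $0$). Let $\Sigma$ be a flat spatial hypersurface immersed in $M$ and carrying Cartesian coordinates: $\Sigma$ is an open subset of $\mathbb R^3$ with coordinates $(x^1,x^2,x^3)=(x,y,z)$, smoothly immersed in $M$ so that the induced metric is $\gamma_{ij}=\delta_{ij}$, with a smooth unit timelike normal field $n$. Let $K_{ij}=-g(\nabla_{\partial_i}n,\partial_j)$ be its extrinsic curvature, $K=K^i{}_i$ its trace, and $P^i{}_j=-K^i{}_j+K\delta^i{}_j$ its canonical ADM momentum. Let $B_{ij}=W^*{}_{i\mu\nu j}n^\mu n^\nu$ be the magnetic part of the Weyl tensor $W$ of $g$, where $W^*{}_{\alpha\beta\mu\nu}=\tfrac12 W_{\alpha\beta\rho\sigma}\varepsilon^{\rho\sigma}{}_{\mu\nu}$ and the volume form is oriented so that $\varepsilon(n,\partial_1,\partial_2,\partial_3)=1$. (The curvature convention is $R^\rho{}_{\sigma\mu\nu}=\partial_\mu\Gamma^\rho_{\nu\sigma}-\dots$,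 $R_{\sigma\nu}=R^\rho{}_{\sigma\rho\nu}$.) For $k\in\{x,y,z\}$ consider on $\Sigma$ the conformal Killing fields $$\mathcal T[k]=\frac{\partial}{\partial x^k},\qquad \mathcal R[k]=\varepsilon_k{}^{ij}x_i\frac{\partial}{\partial x^j},\qquad \mathcal K[k]=x_k\,x^j\frac{\partial}{\partial x^j}-\tfrac12 r^2\frac{\partial}{\partial x^k},\qquad r^2=x^2+y^2+z^2,$$ with $\varepsilon_{123}=1$. Assume that $B$ is divergence-free, $B^i{}_{j|i}=0$ on $\Sigma$. Let $A$ be any closed surface in $\Sigma$, i.e. a smoothly immersed compact two-dimensional surface without boundary, with a continuous unit normal field $\nu$, and write $dS_i=\nu_i\,dS$ with $dS$ the induced area element. If the charges $I(B,\mathcal T[l])=\int_A B^i{}_j\mathcal T^j[l]\,dS_i$ vanish for $l=x,y,z$, then for every $k\in\{x,y,z\}$ $$\int_A B^i{}_j\,\mathcal K^j[k]\,dS_i=\int_A P^i{}_j\,\mathcal R^j[k]\,dS_i .$$ That is, the magnetic charge of the proper conformal generator $\mathcal K[k]$ equals the ADM angular momentum integral about the axis $k$. -/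

import Mathlib

open scoped Manifold ContDiff

noncomputable section

namespace FlatCharge

/-- Euclidean spaces: `E4` models spacetime, `E3` carries the Cartesian coordinates of the flat
hypersurface, and `E2` models two-dimensional surfaces. -/
abbrev E4 : Type := EuclideanSpace ℝ (Fin 4)
abbrev E3 : Type := EuclideanSpace ℝ (Fin 3)
abbrev E2 : Type := EuclideanSpace ℝ (Fin 2)

/-- Partial derivative `∂_i f` of a real function on `ℝⁿ`. -/
def pd {n : ℕ} (i : Fin n) (f : EuclideanSpace ℝ (Fin n) → ℝ) (x : EuclideanSpace ℝ (Fin n)) : ℝ :=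
  fderiv ℝ f x (EuclideanSpace.single i 1)

/-- The totally antisymmetric symbol, `leviCivita ![0, 1, …, n - 1] = 1`. -/
def leviCivita {n : ℕ} (f : Fin n → Fin n) : ℝ :=
  Matrix.det (Matrix.of fun i j : Fin n => if f i = j then (1 : ℝ) else 0)

/-! ### Curvature of a metric given by its components in a coordinate chart -/

section Coordinates

variable (G : E4 → Matrix (Fin 4) (Fin 4) ℝ) (y : E4)

/-- `Γ^l_{mn} = ½ g^{ls} (∂_m g_{sn} + ∂_n g_{sm} - ∂_s g_{mn})`. -/
def christoffel (l m n : Fin 4) : ℝ :=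
  (1 / 2) * ∑ s, (G y)⁻¹ l s *
    (pd m (fun z => G z s n) y + pd n (fun z => G z s m) y - pd s (fun z => G z m n) y)

/-- `R^r_{smn} = ∂_m Γ^r_{ns} - ∂_n Γ^r_{ms} + Γ^r_{ml} Γ^l_{ns} - Γ^r_{nl} Γ^l_{ms}`. -/
def riemannUp (r s m n : Fin 4) : ℝ :=
  pd m (fun z => christoffel G z r n s) y - pd n (fun z => christoffel G z r m s) y
    + ∑ l, (christoffel G y r m l * christoffel G y l n s
      - christoffel G y r n l * christoffel G y l m s)

/-- `R_{abmn}`. -/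
def riemann (a b m n : Fin 4) : ℝ := ∑ r, G y a r * riemannUp G y r b m n

/-- `R_{sn} = R^r_{srn}`. -/
def ricci (s n : Fin 4) : ℝ := ∑ r, riemannUp G y r s r n

/-- The curvature scalar. -/
def scalarCurvature : ℝ := ∑ a, ∑ b, (G y)⁻¹ a b * ricci G y a b

/-- The Weyl tensor in dimension four,
`W_{abmn} = R_{abmn} - (g_{a[m} R_{n]b} - g_{b[m} R_{n]a}) + ⅓ R g_{a[m} g_{n]b}`. -/
def weyl (a b m n : Fin 4) : ℝ :=
  riemann G y a b m n
    - (1 / 2) * (G y a m * ricci G y n b - G y a n * ricci G y m b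
        - G y b m * ricci G y n a + G y b n * ricci G y m a)
    + (1 / 6) * scalarCurvature G y * (G y a m * G y n b - G y a n * G y m b)

end Coordinates

/-! ### Spacetimes -/

/-- The diagonal entries of the Minkowski metric, signature `(-,+,+,+)`. -/
def minkowski : Fin 4 → ℝ := ![-1, 1, 1, 1]

/-- A smooth Lorentzian metric of signature `(-,+,+,+)` on a smooth four-manifold. -/
structure LorentzMetric (M : Type*) [TopologicalSpace M] [ChartedSpace E4 M]
    [IsManifold (𝓡 4) ∞ M] where
  /-- The scalar product on each tangent space. -/
  val (p : M) : TangentSpace (𝓡 4) p →L[ℝ] TangentSpace (𝓡 4) p →L[ℝ] ℝ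
  symm (p : M) (v w : TangentSpace (𝓡 4) p) : val p v w = val p w v
  signature (p : M) : ∃ b : Module.Basis (Fin 4) ℝ (TangentSpace (𝓡 4) p),
    ∀ i j, val p (b i) (b j) = if i = j then minkowski i else 0
  contMDiff : ContMDiff (𝓡 4) ((𝓡 4).prod 𝓘(ℝ, E4 →L[ℝ] E4 →L[ℝ] ℝ)) ∞
    (fun p => Bundle.TotalSpace.mk' (E4 →L[ℝ] E4 →L[ℝ] ℝ)
      (E := fun p : M => TangentSpace (𝓡 4) p →L[ℝ] TangentSpace (𝓡 4) p →L[ℝ] ℝ) p (val p))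

section Spacetime

variable {M : Type*} [TopologicalSpace M] [ChartedSpace E4 M] [IsManifold (𝓡 4) ∞ M]

/-- Components of a tangent vector at `p` in the preferred chart at `p`; Mathlib identifies
`T_pM` with the model space `ℝ⁴` by means of exactly this chart. -/
def comp {p : M} (v : TangentSpace (𝓡 4) p) (μ : Fin 4) : ℝ :=
  WithLp.ofLp (p := 2) (V := Fin 4 → ℝ) v μ

/-- The components `g_{μν}` of the metric as functions on the preferred chart at `p`. -/
def LorentzMetric.inChart (g : LorentzMetric M) (p : M) (y : E4) : Matrix (Fin 4) (Fin 4) ℝ :=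
  Matrix.of fun μ ν =>
    g.val ((extChartAt (𝓡 4) p).symm y)
      (mfderiv 𝓘(ℝ, E4) (𝓡 4) (extChartAt (𝓡 4) p).symm y (EuclideanSpace.single μ (1 : ℝ)))
      (mfderiv 𝓘(ℝ, E4) (𝓡 4) (extChartAt (𝓡 4) p).symm y (EuclideanSpace.single ν (1 : ℝ)))

/-- Einstein's vacuum equations `R_{μν} - ½ R g_{μν} + Λ g_{μν} = 0` at every point. -/
def IsVacuum (g : LorentzMetric M) (Λ : ℝ) : Prop :=
  ∀ (p : M) (μ ν : Fin 4),
    ricci (g.inChart p) (extChartAt (𝓡 4) p p) μ ν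
      - (1 / 2) * scalarCurvature (g.inChart p) (extChartAt (𝓡 4) p p)
          * g.inChart p (extChartAt (𝓡 4) p p) μ ν
      + Λ * g.inChart p (extChartAt (𝓡 4) p p) μ ν = 0

/-- The Weyl tensor of spacetime as a four-linear form on `T_pM`. -/
def weylAt (g : LorentzMetric M) (p : M) (a b c d : TangentSpace (𝓡 4) p) : ℝ :=
  ∑ α, ∑ β, ∑ μ, ∑ ν, weyl (g.inChart p) (extChartAt (𝓡 4) p p) α β μ ν
    * comp a α * comp b β * comp c μ * comp d ν

/-! ### Flat hypersurfaces -/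

/-- An immersed flat spatial hypersurface with its Cartesian coordinates and a unit normal field:
an open set `dom ⊆ ℝ³`, a smooth map `emb` of it into spacetime whose induced metric is the
Euclidean one (so that `emb` is an immersion), and a smooth timelike unit normal field along it.
Values of `emb` and `normal` outside `dom` play no role. -/
structure FlatHypersurface (g : LorentzMetric M) where
  dom : Set E3
  isOpen_dom : IsOpen dom
  emb : E3 → M
  contMDiffOn_emb : ContMDiffOn (𝓡 3) (𝓡 4) ∞ emb dom
  induced : ∀ x ∈ dom, ∀ u v : E3,
    g.val (emb x) (mfderiv (𝓡 3) (𝓡 4) emb x u) (mfderiv (𝓡 3) (𝓡 4) emb x v) = inner ℝ u v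
  normal : (x : E3) → TangentSpace (𝓡 4) (emb x)
  contMDiffOn_normal : ContMDiffOn (𝓡 3) (𝓡 4).tangent ∞
    (fun x => (⟨emb x, normal x⟩ : TangentBundle (𝓡 4) M)) dom
  normal_unit : ∀ x ∈ dom, g.val (emb x) (normal x) (normal x) = -1
  normal_orthogonal : ∀ x ∈ dom, ∀ u : E3,
    g.val (emb x) (normal x) (mfderiv (𝓡 3) (𝓡 4) emb x u) = 0

variable {g : LorentzMetric M} (H : FlatHypersurface g)

/-- The coordinate vector `∂_i` of the hypersurface as a tangent vector of spacetime. -/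
def FlatHypersurface.tangent (x : E3) (i : Fin 3) : TangentSpace (𝓡 4) (H.emb x) :=
  mfderiv (𝓡 3) (𝓡 4) H.emb x (EuclideanSpace.single i (1 : ℝ))

/-- The normal field near `x`, written in the preferred chart at `emb x`. -/
def FlatHypersurface.normalInChart (x z : E3) : E4 :=
  mfderiv (𝓡 4) 𝓘(ℝ, E4) (extChartAt (𝓡 4) (H.emb x)) (H.emb z) (H.normal z)

/-- The spacetime covariant derivative `∇_{∂_i} n` of the normal field along the hypersurface,
`∂_i n^μ + Γ^μ_{αβ} (∂_i)^α n^β` in the preferred chart at the point. -/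
def FlatHypersurface.covDerivNormal (x : E3) (i : Fin 3) : TangentSpace (𝓡 4) (H.emb x) :=
  WithLp.toLp 2 fun μ =>
    pd i (fun z => H.normalInChart x z μ) x
      + ∑ α, ∑ β, christoffel (g.inChart (H.emb x)) (extChartAt (𝓡 4) (H.emb x) (H.emb x)) μ α β
          * comp (H.tangent x i) α * comp (H.normal x) β

/-- The extrinsic curvature `K_{ij} = -g(∇_{∂_i} n, ∂_j)`. -/
def FlatHypersurface.extrinsic (x : E3) : Matrix (Fin 3) (Fin 3) ℝ :=
  Matrix.of fun i j => -g.val (H.emb x) (H.covDerivNormal x i) (H.tangent x j)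

/-- The canonical ADM momentum `P^i_j = -K^i_j + K δ^i_j`. -/
def FlatHypersurface.momentum (x : E3) : Matrix (Fin 3) (Fin 3) ℝ :=
  -H.extrinsic x + (H.extrinsic x).trace • (1 : Matrix (Fin 3) (Fin 3) ℝ)

/-- The orthonormal frame `(n, ∂_1, ∂_2, ∂_3)` of spacetime along the hypersurface. -/
def FlatHypersurface.frame (x : E3) : Fin 4 → TangentSpace (𝓡 4) (H.emb x) :=
  Fin.cons (H.normal x) (H.tangent x)

/-- The dual Weyl tensor `W*_{abcd} = ½ W_{abls} ε^{ls}_{cd}` in the frame `(n, ∂_1, ∂_2, ∂_3)`,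
which is taken to be positively oriented. -/
def FlatHypersurface.dualWeyl (x : E3) (a b c d : Fin 4) : ℝ :=
  (1 / 2) * ∑ l, ∑ s,
    weylAt g (H.emb x) (H.frame x a) (H.frame x b) (H.frame x l) (H.frame x s)
      * minkowski l * minkowski s * leviCivita ![l, s, c, d]

/-- The magnetic part of the Weyl tensor, `B_{ij} = W*_{iμνj} n^μ n^ν`. -/
def FlatHypersurface.magnetic (x : E3) : Matrix (Fin 3) (Fin 3) ℝ :=
  Matrix.of fun i j => H.dualWeyl x i.succ 0 0 j.succ

/-- `B^i_{j|i} = 0`; in Cartesian coordinates covariant derivatives are partial derivatives. -/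
def FlatHypersurface.MagneticDivergenceFree : Prop :=
  ∀ x ∈ H.dom, ∀ j : Fin 3, ∑ i, pd i (fun z => H.magnetic z i j) x = 0

end Spacetime

/-! ### Conformal Killing fields of Euclidean space, in Cartesian coordinates -/

/-- Translation generator `𝒯[k] = ∂_k`. -/
def translationGenerator (k : Fin 3) (_x : E3) : Fin 3 → ℝ := fun j => if j = k then 1 else 0

/-- Rotation generator `ℛ[k] = ε_k^{ij} x_i ∂_j`. -/
def rotationGenerator (k : Fin 3) (x : E3) : Fin 3 → ℝ := fun j => ∑ i, leviCivita ![k, i, j] * x i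

/-- Scaling generator `𝒮 = x^j ∂_j`. -/
def scalingGenerator (x : E3) : Fin 3 → ℝ := fun j => x j

/-- Proper conformal generator `𝒦[k] = x_k 𝒮 - ½ r² ∂_k`. -/
def properConformalGenerator (k : Fin 3) (x : E3) : Fin 3 → ℝ := fun j =>
  x k * scalingGenerator x j - (1 / 2) * ‖x‖ ^ 2 * (if j = k then 1 else 0)

/-! ### Closed surfaces and integrals over them -/

/-- An immersed oriented closed surface in an open set `S ⊆ ℝ³`: a smooth immersion of a compact
two-manifold without boundary, with a continuous unit normal field along it. -/
structure ClosedSurface (S : Set E3) (A : Type*) [TopologicalSpace A] [ChartedSpace E2 A]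
    [IsManifold (𝓡 2) ∞ A] [T2Space A] [CompactSpace A] where
  imm : A → E3
  contMDiff_imm : ContMDiff (𝓡 2) (𝓡 3) ∞ imm
  injective_mfderiv : ∀ a, Function.Injective (mfderiv (𝓡 2) (𝓡 3) imm a)
  imm_mem : ∀ a, imm a ∈ S
  normal : A → E3
  continuous_normal : Continuous normal
  norm_normal : ∀ a, ‖normal a‖ = 1
  normal_orthogonal : ∀ (a : A) (v : TangentSpace (𝓡 2) a),
    inner ℝ (normal a) (mfderiv (𝓡 2) (𝓡 3) imm a v : E3) = 0

section Integral

variable {A : Type*} [TopologicalSpace A] [ChartedSpace E2 A] [IsManifold (𝓡 2) ∞ A] [T2Space A]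
  [CompactSpace A]

variable (A) in
/-- A smooth partition of unity on `A` whose members are supported in the chart domains. -/
def partitionOfUnity : SmoothPartitionOfUnity A (𝓡 2) A Set.univ :=
  (SmoothPartitionOfUnity.exists_isSubordinate_chartAt_source (𝓡 2) A).choose

variable {S : Set E3} (F : ClosedSurface S A)

/-- The area density `√det(∂_a F · ∂_b F)` of the immersion in the chart at `i`. -/
def ClosedSurface.areaDensity (i : A) (y : E2) : ℝ :=
  Real.sqrt (Matrix.det (Matrix.of fun a b : Fin 2 => (inner ℝ
    (fderiv ℝ (F.imm ∘ (extChartAt (𝓡 2) i).symm) y (EuclideanSpace.single a 1))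
    (fderiv ℝ (F.imm ∘ (extChartAt (𝓡 2) i).symm) y (EuclideanSpace.single b 1)) : ℝ)))

/-- The integral `∫_A f dS` with respect to the induced area, assembled from the charts by a
partition of unity (the value does not depend on the partition; the sum is finite since `A` is
compact). -/
def ClosedSurface.integral (f : A → ℝ) : ℝ :=
  ∑ᶠ i : A, ∫ y in (extChartAt (𝓡 2) i).target,
    partitionOfUnity A i ((extChartAt (𝓡 2) i).symm y) * f ((extChartAt (𝓡 2) i).symm y)
      * F.areaDensity i y

/-- The charge `∫_A T^i_j X^j dS_i`, where `dS_i` is the unit normal times the area element. -/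
def ClosedSurface.charge (T : E3 → Matrix (Fin 3) (Fin 3) ℝ) (X : E3 → Fin 3 → ℝ) : ℝ :=
  F.integral fun a => ∑ i, ∑ j, T (F.imm a) i j * X (F.imm a) j * F.normal a i

end Integral

end FlatCharge

end

noncomputable section

namespace FlatCharge

open Matrix Topology Bundle MeasureTheory

/-! ### Partial derivatives -/

section Pd

variable {n : ℕ} {f g : EuclideanSpace ℝ (Fin n) → ℝ} {x : EuclideanSpace ℝ (Fin n)}
  {U : Set (EuclideanSpace ℝ (Fin n))}

/-! The two integrands differ pointwise by a curl, and a curl has no flux through a closed surface.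

Write `X` for the conformal field with index `k` and `K` for the extrinsic curvature. For an
Einstein metric the Weyl and Riemann tensors differ by a multiple of `g_{am} g_{nb} - g_{an}
g_{mb}`, which has no component with exactly one normal index. The Codazzi equation
(`IsFlatInChart.codazzi`), with partial derivatives because the induced metric is Euclidean,
therefore gives `B_{ij} = -ε_{jls} ∂_l K_{si}` (`magnetic_eq`). The antisymmetric part of this
expression is `∂_k K_{jk} - ∂_j K_{kk}`, up to duality, and vanishes by the momentum constraint, so
`B` is symmetric (`magnetic_symm`) and also `B_{ij} = -ε_{ils} ∂_l K_{sj}`. The product rule now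
yields `B_{ij} X_j = -curl(K X)_i + ε_{ils} K_{sj} ∂_l X_j`. Here `∂_l X_j = x_k δ_{jl} + (δ_{kl}
x_j - x_l δ_{jk})`. The trace term drops because `K` is symmetric, and the antisymmetric term
contributes exactly `P_{ij} R_j`, with `R` the rotation about the axis `k` (`magnetic_contract_eq`).

Two pieces of groundwork carry this. The definition of `K` at a point uses the spacetime chart
centred there, so before differentiating one has to know that `K` can be computed in any fixed chart
(`extrinsic_eq_chartExtrinsic`); this rests on the transformation law of the connection, obtained
from uniqueness of the torsion-free metric connection. Stokes' theorem for immersed closed surfaces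
(`integral_curlFlux`) is proved by a partition of unity: each `d(χ V)` lives in one chart, where it
integrates to zero, and the sum of these forms is `dV` because the `χ` add up to one. -/

lemma pd_congr (i : Fin n) (h : f =ᶠ[𝓝 x] g) : pd i f x = pd i g x := by
  simp only [pd, h.fderiv_eq]

lemma pd_congr_on (hU : IsOpen U) (h : ∀ z ∈ U, f z = g z) (hx : x ∈ U) (i : Fin n) :
    pd i f x = pd i g x :=
  pd_congr i (Filter.eventuallyEq_of_mem (hU.mem_nhds hx) h)

lemma pd_const (i : Fin n) (c : ℝ) : pd i (fun _ => c) x = 0 := by simp [pd]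

lemma pd_add (i : Fin n) (hf : DifferentiableAt ℝ f x) (hg : DifferentiableAt ℝ g x) :
    pd i (fun z => f z + g z) x = pd i f x + pd i g x := by
  simp [pd, fderiv_fun_add hf hg]

lemma pd_sub (i : Fin n) (hf : DifferentiableAt ℝ f x) (hg : DifferentiableAt ℝ g x) :
    pd i (fun z => f z - g z) x = pd i f x - pd i g x := by
  simp [pd, fderiv_fun_sub hf hg]

lemma pd_neg (i : Fin n) : pd i (fun z => - f z) x = - pd i f x := by
  simp [pd, fderiv_fun_neg]

lemma pd_mul (i : Fin n) (hf : DifferentiableAt ℝ f x) (hg : DifferentiableAt ℝ g x) :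
    pd i (fun z => f z * g z) x = pd i f x * g x + f x * pd i g x := by
  simp [pd, fderiv_fun_mul hf hg]; ring

lemma pd_sum {ι : Type*} (s : Finset ι) (i : Fin n) {f : ι → EuclideanSpace ℝ (Fin n) → ℝ}
    (hf : ∀ a ∈ s, DifferentiableAt ℝ (f a) x) :
    pd i (fun z => ∑ a ∈ s, f a z) x = ∑ a ∈ s, pd i (f a) x := by
  simp [pd, fderiv_fun_sum hf]

lemma pd_coord (i j : Fin n) :
    pd i (fun z : EuclideanSpace ℝ (Fin n) => z j) x = if j = i then 1 else 0 := by
  have : HasFDerivAt (fun z : EuclideanSpace ℝ (Fin n) => z j)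
      (EuclideanSpace.proj j : EuclideanSpace ℝ (Fin n) →L[ℝ] ℝ) x :=
    (EuclideanSpace.proj j : EuclideanSpace ℝ (Fin n) →L[ℝ] ℝ).hasFDerivAt
  simp [pd, this.fderiv, PiLp.single_apply]

lemma fderiv_eq_sum_pd {m : ℕ} {f : EuclideanSpace ℝ (Fin m) → ℝ} {y : EuclideanSpace ℝ (Fin m)}
    (v : EuclideanSpace ℝ (Fin m)) : fderiv ℝ f y v = ∑ a, pd a f y * v a := by
  have hv : v = ∑ a, v a • EuclideanSpace.single a (1 : ℝ) := by
    ext b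
    simp [Pi.single_apply]
  conv_lhs => rw [hv]
  simp [pd, mul_comm]

lemma fderiv_apply_coord {m : ℕ} {F : EuclideanSpace ℝ (Fin n) → EuclideanSpace ℝ (Fin m)}
    (hF : DifferentiableAt ℝ F x) (v : EuclideanSpace ℝ (Fin n)) (a : Fin m) :
    fderiv ℝ F x v a = fderiv ℝ (fun z => F z a) x v := by
  have := ((EuclideanSpace.proj a : EuclideanSpace ℝ (Fin m) →L[ℝ] ℝ).hasFDerivAt.comp x
    hF.hasFDerivAt)
  have h2 : HasFDerivAt (fun z => F z a) ((EuclideanSpace.proj a : EuclideanSpace ℝ (Fin m) →L[ℝ] ℝ)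
    ∘L fderiv ℝ F x) x := this
  rw [h2.fderiv]; rfl

lemma pd_comp {m : ℕ} {f : EuclideanSpace ℝ (Fin m) → ℝ}
    {F : EuclideanSpace ℝ (Fin n) → EuclideanSpace ℝ (Fin m)} (i : Fin n)
    (hf : DifferentiableAt ℝ f (F x)) (hF : DifferentiableAt ℝ F x) :
    pd i (fun z => f (F z)) x = ∑ a, pd a f (F x) * pd i (fun z => F z a) x := by
  have : fderiv ℝ (fun z => f (F z)) x = (fderiv ℝ f (F x)).comp (fderiv ℝ F x) :=
    fderiv_comp x hf hF
  rw [pd, this, ContinuousLinearMap.comp_apply, fderiv_eq_sum_pd]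
  simp only [fderiv_apply_coord hF, pd]

lemma contDiffOn_pd (hU : IsOpen U) (hf : ContDiffOn ℝ ∞ f U) (i : Fin n) :
    ContDiffOn ℝ ∞ (pd i f) U := by
  have h : ContDiffOn ℝ ∞ (fderiv ℝ f) U := hf.fderiv_of_isOpen hU (by simp)
  exact h.clm_apply contDiffOn_const

lemma pd_comm (hU : IsOpen U) (hf : ContDiffOn ℝ ∞ f U) (hx : x ∈ U) (i j : Fin n) :
    pd i (pd j f) x = pd j (pd i f) x := by
  have h : ContDiffAt ℝ ∞ f x := hf.contDiffAt (hU.mem_nhds hx)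
  have hs := (h.isSymmSndFDerivAt (by
    simp [minSmoothness_of_isRCLikeNormedField]
    exact WithTop.coe_le_coe.2 le_top)).eq (EuclideanSpace.single i (1 : ℝ))
    (EuclideanSpace.single j (1 : ℝ))
  have hd : DifferentiableAt ℝ (fderiv ℝ f) x :=
    (h.fderiv_right (m := 1) (by norm_cast)).differentiableAt one_ne_zero
  have key : ∀ k l : Fin n, pd k (pd l f) x
      = fderiv ℝ (fderiv ℝ f) x (EuclideanSpace.single k 1) (EuclideanSpace.single l 1) := by
    intro k l
    have := hd.hasFDerivAt.clm_apply (hasFDerivAt_const (EuclideanSpace.single l (1 : ℝ)) x)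
    have h2 : HasFDerivAt (pd l f) _ x := this
    rw [pd, h2.fderiv]
    simp
  rw [key, key, hs]

lemma ContDiffOn.diffAt {F' : Type*} [NormedAddCommGroup F'] [NormedSpace ℝ F']
    {h : EuclideanSpace ℝ (Fin n) → F'} (hU : IsOpen U)
    (hf : ContDiffOn ℝ ∞ h U) (hx : x ∈ U) : DifferentiableAt ℝ h x :=
  (hf.contDiffAt (hU.mem_nhds hx)).differentiableAt (by simp)

end Pd

/-! ### Matrix valued functions -/

section PdM

variable {n : ℕ} {ι κ l : Type*}
  {x : EuclideanSpace ℝ (Fin n)} {U : Set (EuclideanSpace ℝ (Fin n))}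

/-- Entrywise partial derivative. -/
def pdM (i : Fin n) (A : EuclideanSpace ℝ (Fin n) → Matrix ι κ ℝ) (x : EuclideanSpace ℝ (Fin n)) :
    Matrix ι κ ℝ := Matrix.of fun a b => pd i (fun z => A z a b) x

/-- Entrywise smoothness on a set. -/
def SmoothM (A : EuclideanSpace ℝ (Fin n) → Matrix ι κ ℝ) (U : Set (EuclideanSpace ℝ (Fin n))) :
    Prop := ∀ a b, ContDiffOn ℝ ∞ (fun z => A z a b) U

lemma SmoothM.diffAt {A : EuclideanSpace ℝ (Fin n) → Matrix ι κ ℝ} (hA : SmoothM A U)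
    (hU : IsOpen U) (hx : x ∈ U) (a : ι) (b : κ) : DifferentiableAt ℝ (fun z => A z a b) x :=
  ContDiffOn.diffAt hU (hA a b) hx

lemma SmoothM.mul [Fintype κ] {A : EuclideanSpace ℝ (Fin n) → Matrix ι κ ℝ}
    {B : EuclideanSpace ℝ (Fin n) → Matrix κ l ℝ} (hA : SmoothM A U) (hB : SmoothM B U) :
    SmoothM (fun z => A z * B z) U := by
  intro a b
  simp only [Matrix.mul_apply]
  exact ContDiffOn.sum fun c _ => (hA a c).mul (hB c b)

lemma SmoothM.add {A B : EuclideanSpace ℝ (Fin n) → Matrix ι κ ℝ}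
    (hA : SmoothM A U) (hB : SmoothM B U) : SmoothM (fun z => A z + B z) U :=
  fun a b => (hA a b).add (hB a b)

lemma SmoothM.transpose {A : EuclideanSpace ℝ (Fin n) → Matrix ι κ ℝ} (hA : SmoothM A U) :
    SmoothM (fun z => (A z)ᵀ) U := fun a b => hA b a

lemma SmoothM.pdM {A : EuclideanSpace ℝ (Fin n) → Matrix ι κ ℝ} (hA : SmoothM A U)
    (hU : IsOpen U) (i : Fin n) : SmoothM (pdM i A) U :=
  fun a b => contDiffOn_pd hU (hA a b) i

lemma pdM_mul [Fintype κ] {A : EuclideanSpace ℝ (Fin n) → Matrix ι κ ℝ}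
    {B : EuclideanSpace ℝ (Fin n) → Matrix κ l ℝ} (hA : SmoothM A U) (hB : SmoothM B U)
    (hU : IsOpen U) (hx : x ∈ U) (i : Fin n) :
    pdM i (fun z => A z * B z) x = pdM i A x * B x + A x * pdM i B x := by
  ext a b
  simp only [pdM, Matrix.mul_apply, Matrix.of_apply, Matrix.add_apply]
  rw [pd_sum (f := fun c z => A z a c * B z c b) _ _
      fun c _ => (hA.diffAt hU hx a c).mul (hB.diffAt hU hx c b),
    ← Finset.sum_add_distrib]
  exact Finset.sum_congr rfl fun c _ => pd_mul i (hA.diffAt hU hx a c) (hB.diffAt hU hx c b)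

lemma pdM_add {A B : EuclideanSpace ℝ (Fin n) → Matrix ι κ ℝ} (hA : SmoothM A U)
    (hB : SmoothM B U) (hU : IsOpen U) (hx : x ∈ U) (i : Fin n) :
    pdM i (fun z => A z + B z) x = pdM i A x + pdM i B x := by
  ext a b
  exact pd_add i (hA.diffAt hU hx a b) (hB.diffAt hU hx a b)

lemma pdM_transpose {A : EuclideanSpace ℝ (Fin n) → Matrix ι κ ℝ} (i : Fin n) :
    pdM i (fun z => (A z)ᵀ) x = (pdM i A x)ᵀ := rfl

lemma pdM_congr_on {A B : EuclideanSpace ℝ (Fin n) → Matrix ι κ ℝ} (hU : IsOpen U)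
    (h : ∀ z ∈ U, A z = B z) (hx : x ∈ U) (i : Fin n) : pdM i A x = pdM i B x := by
  ext a b
  exact pd_congr_on hU (fun z hz => by rw [h z hz]) hx i

lemma pdM_comm {A : EuclideanSpace ℝ (Fin n) → Matrix ι κ ℝ} (hA : SmoothM A U) (hU : IsOpen U)
    (hx : x ∈ U) (i j : Fin n) : pdM i (pdM j A) x = pdM j (pdM i A) x := by
  ext a b
  exact pd_comm hU (hA a b) hx i j

end PdM

/-! ### The Levi-Civita connection of a metric given in coordinates -/

section LeviCivita

variable {G : E4 → Matrix (Fin 4) (Fin 4) ℝ} {W : Set E4} {y : E4}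

/-- The connection matrices `(Γ_α)^μ_β`. -/
def gammaM (G : E4 → Matrix (Fin 4) (Fin 4) ℝ) (α : Fin 4) (y : E4) : Matrix (Fin 4) (Fin 4) ℝ :=
  Matrix.of fun μ β => christoffel G y μ α β

/-- The curvature matrices `R^r_{smn}`, as matrices in `r`, `s`. -/
def curvM (G : E4 → Matrix (Fin 4) (Fin 4) ℝ) (m n : Fin 4) (y : E4) : Matrix (Fin 4) (Fin 4) ℝ :=
  pdM m (gammaM G n) y - pdM n (gammaM G m) y
    + (gammaM G m y * gammaM G n y - gammaM G n y * gammaM G m y)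

/-- Matrix notation makes the curvature `dΓ + Γ ∧ Γ`, so that the later identities become
noncommutative algebra in place of index sums. -/
lemma riemannUp_eq_curvM (r s m n : Fin 4) : riemannUp G y r s m n = curvM G m n y r s := by
  simp [riemannUp, curvM, pdM, gammaM, Matrix.mul_apply, Finset.sum_sub_distrib]

lemma riemann_eq_curvM (a b m n : Fin 4) :
    riemann G y a b m n = (G y * curvM G m n y) a b := by
  simp [riemann, Matrix.mul_apply, riemannUp_eq_curvM]

lemma pd_metric_symm (hW : IsOpen W) (hG : ∀ z ∈ W, (G z)ᵀ = G z) (hy : y ∈ W) (s m n : Fin 4) :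
    pd s (fun z => G z m n) y = pd s (fun z => G z n m) y :=
  pd_congr_on hW (fun z hz => by conv_lhs => rw [← hG z hz, Matrix.transpose_apply]) hy s

lemma christoffel_symm (hW : IsOpen W) (hG : ∀ z ∈ W, (G z)ᵀ = G z) (hy : y ∈ W) (l m n : Fin 4) :
    christoffel G y l m n = christoffel G y l n m := by
  unfold christoffel
  congr 1
  refine Finset.sum_congr rfl fun s _ => ?_
  rw [pd_metric_symm hW hG hy s m n]
  ring

lemma metric_mul_gammaM (hdet : IsUnit (G y).det) (s α β : Fin 4) :
    (G y * gammaM G α y) s β = (1 / 2) * (pd α (fun z => G z s β) y + pd β (fun z => G z s α) y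
      - pd s (fun z => G z α β) y) := by
  have h : (fun l => gammaM G α y l β) = (G y)⁻¹ *ᵥ fun s => (1 / 2) *
      (pd α (fun z => G z s β) y + pd β (fun z => G z s α) y - pd s (fun z => G z α β) y) := by
    ext l
    simp only [gammaM, christoffel, Matrix.of_apply, Matrix.mulVec, dotProduct, Finset.mul_sum]
    exact Finset.sum_congr rfl fun s _ => by ring
  have h2 : (G y * gammaM G α y) s β = (G y *ᵥ fun l => gammaM G α y l β) s := rfl
  rw [h2, h, Matrix.mulVec_mulVec, Matrix.mul_nonsing_inv _ hdet, Matrix.one_mulVec]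

/-- Metric compatibility: in the sum of two Christoffel symbols of the first kind the derivatives of
the other two entries cancel. -/
lemma pdM_metric (hW : IsOpen W) (hG : ∀ z ∈ W, (G z)ᵀ = G z) (hy : y ∈ W)
    (hdet : IsUnit (G y).det) (α : Fin 4) :
    pdM α G y = G y * gammaM G α y + (G y * gammaM G α y)ᵀ := by
  ext s β
  rw [Matrix.add_apply, Matrix.transpose_apply, metric_mul_gammaM hdet, metric_mul_gammaM hdet,
    pd_metric_symm hW hG hy β α s, pd_metric_symm hW hG hy s α β, pd_metric_symm hW hG hy α β s]
  simp only [pdM, Matrix.of_apply]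
  ring

/-- The torsion-free metric connection is unique. -/
lemma eq_gammaM (hdet : IsUnit (G y).det) {C : Fin 4 → Matrix (Fin 4) (Fin 4) ℝ}
    (hsymm : ∀ α β μ, C α μ β = C β μ α)
    (hmetric : ∀ α, pdM α G y = G y * C α + (G y * C α)ᵀ) (α : Fin 4) : C α = gammaM G α y := by
  have key : G y * C α = G y * gammaM G α y := by
    ext s β
    have h : ∀ a b c : Fin 4, pd a (fun z => G z b c) y = (G y * C a) b c + (G y * C a) c b :=
      fun a b c => congrFun (congrFun (hmetric a) b) c
    have hs : ∀ a b c : Fin 4, (G y * C a) b c = (G y * C c) b a := fun a b c => by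
      simp only [Matrix.mul_apply, hsymm a c]
    -- Koszul's argument: of the six terms produced by `h`, symmetry cancels four and identifies the
    -- remaining two.
    rw [metric_mul_gammaM hdet, h, h, h, hs β s α, hs s β α, hs s α β, hs β α s]
    ring
  calc C α = (G y)⁻¹ * (G y * C α) := by
        rw [← Matrix.mul_assoc, Matrix.nonsing_inv_mul _ hdet, Matrix.one_mul]
    _ = gammaM G α y := by
        rw [key, ← Matrix.mul_assoc, Matrix.nonsing_inv_mul _ hdet, Matrix.one_mul]

/-- Cramer's rule: each entry of the inverse is a quotient of determinants, hence of polynomials in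
the entries. -/
lemma smoothM_inv (hG : SmoothM G W) (hdet : ∀ z ∈ W, IsUnit (G z).det) :
    SmoothM (fun z => (G z)⁻¹) W := by
  intro a b
  have hd : ∀ A : E4 → Matrix (Fin 4) (Fin 4) ℝ, SmoothM A W →
      ContDiffOn ℝ ∞ (fun z => (A z).det) W := by
    intro A hA
    simp only [Matrix.det_apply]
    exact ContDiffOn.sum fun σ _ => (contDiffOn_prod fun c _ => hA _ _).const_smul _
  have : (fun z => (G z)⁻¹ a b) = fun z => ((G z).det)⁻¹ * ((G z).updateRow b (Pi.single a 1)).det := by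
    ext z
    rw [Matrix.inv_def, Ring.inverse_eq_inv', Matrix.smul_apply, Matrix.adjugate_apply, smul_eq_mul]
  rw [this]
  refine ((hd G hG).inv fun z hz => (hdet z hz).ne_zero).mul (hd _ fun c d => ?_)
  by_cases hcb : c = b
  · subst hcb; simp only [Matrix.updateRow_self]; exact contDiffOn_const
  · simp only [Matrix.updateRow_ne hcb]; exact hG c d

lemma smoothM_gammaM (hW : IsOpen W) (hG : SmoothM G W) (hdet : ∀ z ∈ W, IsUnit (G z).det)
    (α : Fin 4) : SmoothM (gammaM G α) W := by
  intro μ β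
  refine contDiffOn_const.mul (ContDiffOn.sum fun s _ => (smoothM_inv hG hdet μ s).mul ?_)
  exact ((contDiffOn_pd hW (hG s β) α).add (contDiffOn_pd hW (hG s α) β)).sub
    (contDiffOn_pd hW (hG α β) s)

/-- Differentiating metric compatibility once more and commuting the second derivatives of `G`
leaves precisely the symmetric part of `G * R`, which must be zero. -/
lemma metric_mul_curvM_antisymm (hW : IsOpen W) (hsm : SmoothM G W) (hG : ∀ z ∈ W, (G z)ᵀ = G z)
    (hdet : ∀ z ∈ W, IsUnit (G z).det) (hy : y ∈ W) (m n : Fin 4) :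
    G y * curvM G m n y + (G y * curvM G m n y)ᵀ = 0 := by
  have hΓ := smoothM_gammaM hW hsm hdet
  have h2 : ∀ a b, pdM a (pdM b G) y = (pdM a G y * gammaM G b y + G y * pdM a (gammaM G b) y)
      + (pdM a G y * gammaM G b y + G y * pdM a (gammaM G b) y)ᵀ := by
    intro a b
    rw [pdM_congr_on hW (fun z hz => pdM_metric hW hG hz (hdet z hz) b) hy,
      pdM_add (hsm.mul (hΓ b)) (hsm.mul (hΓ b)).transpose hW hy, pdM_transpose,
      pdM_mul hsm (hΓ b) hW hy]
  have h3 := pdM_comm hsm hW hy m n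
  rw [h2, h2, pdM_metric hW hG hy (hdet y hy) m, pdM_metric hW hG hy (hdet y hy) n,
    ← sub_eq_zero] at h3
  rw [← h3, curvM]
  simp only [Matrix.transpose_add, Matrix.transpose_sub, Matrix.transpose_mul, hG y hy,
    Matrix.mul_add, Matrix.mul_sub, Matrix.add_mul, Matrix.mul_assoc, Matrix.transpose_transpose]
  abel

/-- The transformation law of the connection matrices under a change of coordinates `τ`. -/
lemma gammaM_transform {G' : E4 → Matrix (Fin 4) (Fin 4) ℝ} {W' : Set E4} {τ : E4 → E4}
    (hW : IsOpen W) (hW' : IsOpen W') (hτ : ContDiffOn ℝ ∞ τ W) (hmaps : ∀ z ∈ W, τ z ∈ W')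
    (hsm' : SmoothM G' W') (hG' : ∀ z ∈ W', (G' z)ᵀ = G' z)
    (hdet' : ∀ z ∈ W', IsUnit (G' z).det) (hdet : ∀ z ∈ W, IsUnit (G z).det)
    {J : E4 → Matrix (Fin 4) (Fin 4) ℝ}
    (hJ : ∀ z μ α, J z μ α = pd α (fun w => τ w μ) z)
    (hGG' : ∀ z ∈ W, G z = (J z)ᵀ * G' (τ z) * J z) (hy : y ∈ W) (α : Fin 4) :
    J y * gammaM G α y
      = (∑ β, J y β α • gammaM G' β (τ y)) * J y + pdM α J y := by
  have hτc : ∀ μ, ContDiffOn ℝ ∞ (fun w => τ w μ) W := fun μ => by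
    exact (contDiffOn_euclidean.1 hτ) μ
  have hJs : SmoothM J W := by
    intro μ β
    have : (fun z => J z μ β) = pd β (fun w => τ w μ) := funext fun z => hJ z μ β
    rw [this]
    exact contDiffOn_pd hW (hτc μ) β
  have hJsymm : ∀ a b μ, pdM a J y μ b = pdM b J y μ a := by
    intro a b μ
    simp only [pdM, Matrix.of_apply, hJ]
    exact pd_comm hW (hτc μ) hy a b
  have hJdet : IsUnit (J y).det := by
    have h := hdet y hy
    rw [hGG' y hy, Matrix.det_mul] at h
    exact isUnit_of_mul_isUnit_right h
  set D : Fin 4 → Matrix (Fin 4) (Fin 4) ℝ := fun α =>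
    (∑ β, J y β α • gammaM G' β (τ y)) * J y + pdM α J y with hD
  have hG'τ : SmoothM (fun z => G' (τ z)) W := fun a b => (hsm' a b).comp hτ hmaps
  have hpdG' : ∀ a, pdM a (fun z => G' (τ z)) y
      = G' (τ y) * (∑ β, J y β a • gammaM G' β (τ y))
        + (G' (τ y) * (∑ β, J y β a • gammaM G' β (τ y)))ᵀ := by
    intro a
    have h1 : pdM a (fun z => G' (τ z)) y = ∑ β, J y β a • pdM β G' (τ y) := by
      ext b c
      have := pd_comp (f := fun w => G' w b c) a (hsm'.diffAt hW' (hmaps y hy) b c)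
        (ContDiffOn.diffAt hW hτ hy)
      simp only [pdM, Matrix.of_apply, this, Matrix.sum_apply, Matrix.smul_apply, hJ, smul_eq_mul,
        mul_comm]
    rw [h1, Finset.mul_sum, Matrix.transpose_sum, ← Finset.sum_add_distrib]
    refine Finset.sum_congr rfl fun β _ => ?_
    rw [pdM_metric hW' hG' (hmaps y hy) (hdet' _ (hmaps y hy)), smul_add, Matrix.mul_smul,
      Matrix.transpose_smul]
  -- `J⁻¹ D` is the connection of `G'` brought back to the first chart. It is torsion-free because
  -- `∂J` is a second derivative of `τ`, and metric by the product rule on `Jᵀ G' J`; uniqueness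
  -- identifies it with `gammaM G`.
  have key : (J y)⁻¹ * D α = gammaM G α y := by
    refine eq_gammaM (C := fun α => (J y)⁻¹ * D α) (hdet y hy) ?_ ?_ α
    · intro a b μ
      have hDs : ∀ ν, D a ν b = D b ν a := by
        intro ν
        simp only [hD, Matrix.add_apply, Matrix.mul_apply, Matrix.sum_apply, Matrix.smul_apply,
          smul_eq_mul, hJsymm a b ν, gammaM, Matrix.of_apply, Finset.sum_mul]
        rw [Finset.sum_comm]
        congr 1
        refine Finset.sum_congr rfl fun c _ => Finset.sum_congr rfl fun d _ => ?_
        rw [christoffel_symm hW' hG' (hmaps y hy) ν c d]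
        ring
      simp only [Matrix.mul_apply, hDs]
    · intro a
      have h1 : G y * ((J y)⁻¹ * D a) = (J y)ᵀ * G' (τ y) * D a := by
        rw [hGG' y hy, Matrix.mul_assoc _ (J y), ← Matrix.mul_assoc (J y),
          Matrix.mul_nonsing_inv _ hJdet, Matrix.one_mul]
      rw [h1, pdM_congr_on hW hGG' hy, pdM_mul (hJs.transpose.mul hG'τ) hJs hW hy,
        pdM_mul hJs.transpose hG'τ hW hy, hpdG', pdM_transpose]
      simp only [hD, Matrix.transpose_add, Matrix.transpose_mul, hG' _ (hmaps y hy),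
        Matrix.mul_add, Matrix.add_mul, Matrix.mul_assoc, Matrix.transpose_transpose]
      abel
  rw [← key, ← Matrix.mul_assoc, Matrix.mul_nonsing_inv _ hJdet, Matrix.one_mul]

end LeviCivita

lemma sum_rotate {ι R : Type*} [Fintype ι] [AddCommMonoid R] (f : ι → ι → ι → R) :
    ∑ a, ∑ b, ∑ c, f a b c = ∑ b, ∑ c, ∑ a, f a b c := by
  rw [Finset.sum_comm]
  exact Finset.sum_congr rfl fun b _ => Finset.sum_comm

/-! ### Hypersurfaces in a coordinate chart -/

section Chart

variable {G : E4 → Matrix (Fin 4) (Fin 4) ℝ} {W : Set E4} {F : E3 → E4} {N : E3 → Fin 4 → ℝ}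
  {U : Set E3} {x : E3}

/-- The connection pulled back along `F`: `(ω_i)^μ_β = Γ^μ_{αβ} ∂_i F^α`. -/
def pullbackConnection (G : E4 → Matrix (Fin 4) (Fin 4) ℝ) (F : E3 → E4) (i : Fin 3) (z : E3) :
    Matrix (Fin 4) (Fin 4) ℝ :=
  ∑ α, pd i (fun w => F w α) z • gammaM G α (F z)

/-- The covariant derivative along `F` of a vector field along `F`. -/
def covDerivAlong (G : E4 → Matrix (Fin 4) (Fin 4) ℝ) (F : E3 → E4) (V : E3 → Fin 4 → ℝ)
    (i : Fin 3) (z : E3) : Fin 4 → ℝ :=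
  fun μ => pd i (fun w => V w μ) z + (pullbackConnection G F i z *ᵥ V z) μ

/-- The frame `(N, ∂_1 F, ∂_2 F, ∂_3 F)`, as the columns of a matrix. -/
def frameM (F : E3 → E4) (N : E3 → Fin 4 → ℝ) (z : E3) : Matrix (Fin 4) (Fin 4) ℝ :=
  Matrix.of fun μ a => (Fin.cons (N z μ) fun i => pd i (fun w => F w μ) z : Fin 4 → ℝ) a

/-- The covariant derivatives of the frame. -/
def covFrame (G : E4 → Matrix (Fin 4) (Fin 4) ℝ) (F : E3 → E4) (N : E3 → Fin 4 → ℝ) (i : Fin 3)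
    (z : E3) : Matrix (Fin 4) (Fin 4) ℝ :=
  pdM i (frameM F N) z + pullbackConnection G F i z * frameM F N z

/-- The connection coefficients `g(e_a, ∇_i e_b)` of the frame. -/
def frameConnection (G : E4 → Matrix (Fin 4) (Fin 4) ℝ) (F : E3 → E4) (N : E3 → Fin 4 → ℝ)
    (i : Fin 3) (z : E3) : Matrix (Fin 4) (Fin 4) ℝ :=
  (frameM F N z)ᵀ * G (F z) * covFrame G F N i z

/-- The extrinsic curvature in a chart. -/
def chartExtrinsic (G : E4 → Matrix (Fin 4) (Fin 4) ℝ) (F : E3 → E4) (N : E3 → Fin 4 → ℝ)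
    (i j : Fin 3) (z : E3) : ℝ :=
  -frameConnection G F N i z j.succ 0


variable (G W F N U) in
/-- A flat hypersurface with unit normal, described in one coordinate chart. -/
structure IsFlatInChart : Prop where
  isOpen_W : IsOpen W
  isOpen_U : IsOpen U
  smooth_metric : SmoothM G W
  symm_metric : ∀ y ∈ W, (G y)ᵀ = G y
  det_metric : ∀ y ∈ W, IsUnit (G y).det
  smooth_map : ContDiffOn ℝ ∞ F U
  mapsTo : ∀ z ∈ U, F z ∈ W
  smooth_normal : ∀ μ, ContDiffOn ℝ ∞ (fun z => N z μ) U
  orthonormal : ∀ z ∈ U, (frameM F N z)ᵀ * G (F z) * frameM F N z = Matrix.diagonal minkowski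

/-- Covariant differentiation along a map does not depend on the coordinates. -/
lemma covDerivAlong_transform {G' : E4 → Matrix (Fin 4) (Fin 4) ℝ} {W' : Set E4} {τ : E4 → E4}
    (hW : IsOpen W) (hW' : IsOpen W') (hτ : ContDiffOn ℝ ∞ τ W) (hmaps : ∀ z ∈ W, τ z ∈ W')
    (hsm' : SmoothM G' W') (hG' : ∀ z ∈ W', (G' z)ᵀ = G' z)
    (hdet' : ∀ z ∈ W', IsUnit (G' z).det) (hdet : ∀ z ∈ W, IsUnit (G z).det)
    {J : E4 → Matrix (Fin 4) (Fin 4) ℝ}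
    (hJ : ∀ z μ α, J z μ α = pd α (fun w => τ w μ) z)
    (hGG' : ∀ z ∈ W, G z = (J z)ᵀ * G' (τ z) * J z)
    (hF : DifferentiableAt ℝ F x) (hx : F x ∈ W)
    (hN : ∀ μ, DifferentiableAt ℝ (fun z => N z μ) x) (i : Fin 3) :
    J (F x) *ᵥ covDerivAlong G F N i x
      = covDerivAlong G' (fun z => τ (F z)) (fun z => J (F z) *ᵥ N z) i x := by
  have hτc : ∀ μ, ContDiffOn ℝ ∞ (fun w => τ w μ) W := (contDiffOn_euclidean.1 hτ)
  have hJs : SmoothM J W := by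
    intro μ β
    have : (fun z => J z μ β) = pd β (fun w => τ w μ) := funext fun z => hJ z μ β
    rw [this]
    exact contDiffOn_pd hW (hτc μ) β
  have hJd : ∀ μ β, DifferentiableAt ℝ (fun z => J (F z) μ β) x := fun μ β =>
    (hJs.diffAt hW hx μ β).comp x hF
  have hpdτ : ∀ β, pd i (fun z => τ (F z) β) x = ∑ α, J (F x) β α * pd i (fun w => F w α) x := by
    intro β
    rw [pd_comp (f := fun y => τ y β) i (ContDiffOn.diffAt hW (hτc β) hx) hF]
    simp only [hJ]
  -- The inhomogeneous term `∂J` of the transformation law appears here; it is the term that the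
  -- product rule creates in `h5` when `J N` is differentiated.
  have h1 : J (F x) * pullbackConnection G F i x
      = pullbackConnection G' (fun z => τ (F z)) i x * J (F x)
        + ∑ α, pd i (fun w => F w α) x • pdM α J (F x) := by
    simp only [pullbackConnection, Finset.mul_sum, Matrix.mul_smul,
      gammaM_transform hW hW' hτ hmaps hsm' hG' hdet' hdet hJ hGG' hx, smul_add,
      Finset.sum_add_distrib, hpdτ]
    congr 1
    simp only [Finset.sum_smul, Finset.sum_mul, Finset.smul_sum, Matrix.smul_mul, smul_smul]
    rw [Finset.sum_comm]
    simp only [mul_comm]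
  have h2 : ∀ μ β, pd i (fun z => J (F z) μ β) x
      = (∑ α, pd i (fun w => F w α) x • pdM α J (F x)) μ β := by
    intro μ β
    rw [pd_comp (f := fun y => J y μ β) i (hJs.diffAt hW hx μ β) hF]
    simp [Matrix.sum_apply, pdM, mul_comm]
  have h3 : covDerivAlong G F N i x = (fun μ => pd i (fun w => N w μ) x)
      + pullbackConnection G F i x *ᵥ N x := rfl
  have h4 : covDerivAlong G' (fun z => τ (F z)) (fun z => J (F z) *ᵥ N z) i x
      = (fun μ => pd i (fun w => (J (F w) *ᵥ N w) μ) x)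
      + pullbackConnection G' (fun z => τ (F z)) i x *ᵥ (J (F x) *ᵥ N x) := rfl
  have h5 : (fun μ => pd i (fun w => (J (F w) *ᵥ N w) μ) x)
      = (∑ α, pd i (fun w => F w α) x • pdM α J (F x)) *ᵥ N x
        + J (F x) *ᵥ fun μ => pd i (fun w => N w μ) x := by
    ext μ
    simp only [Matrix.mulVec, dotProduct, Pi.add_apply]
    rw [pd_sum (f := fun β w => J (F w) μ β * N w β) _ _ fun β _ => (hJd μ β).mul (hN β),
      ← Finset.sum_add_distrib]
    refine Finset.sum_congr rfl fun β _ => ?_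
    rw [pd_mul i (hJd μ β) (hN β), h2]
  rw [h3, h4, h5, Matrix.mulVec_add, Matrix.mulVec_mulVec, h1, Matrix.add_mulVec,
    Matrix.mulVec_mulVec]
  abel

/-! ### Frame connection, Codazzi equation and momentum constraint in one chart. -/

namespace IsFlatInChart

variable (h : IsFlatInChart G W F N U)
include h

lemma smooth_coord (μ : Fin 4) : ContDiffOn ℝ ∞ (fun z => F z μ) U :=
  contDiffOn_euclidean.1 h.smooth_map μ

lemma smooth_frameM : SmoothM (frameM F N) U := by
  intro μ a
  refine Fin.cases ?_ (fun i => ?_) a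
  · exact h.smooth_normal μ
  · exact contDiffOn_pd h.isOpen_U (h.smooth_coord μ) i

lemma smooth_metric_comp : SmoothM (fun z => G (F z)) U :=
  fun a b => (h.smooth_metric a b).comp h.smooth_map h.mapsTo

lemma smooth_pullbackConnection (i : Fin 3) : SmoothM (pullbackConnection G F i) U := by
  intro a b
  simp only [pullbackConnection, Matrix.sum_apply, Matrix.smul_apply, smul_eq_mul]
  exact ContDiffOn.sum fun α _ => (contDiffOn_pd h.isOpen_U (h.smooth_coord α) i).mul
    ((smoothM_gammaM h.isOpen_W h.smooth_metric h.det_metric α a b).comp h.smooth_map h.mapsTo)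

lemma smooth_covFrame (i : Fin 3) : SmoothM (covFrame G F N i) U :=
  (h.smooth_frameM.pdM h.isOpen_U i).add ((h.smooth_pullbackConnection i).mul h.smooth_frameM)

lemma smooth_frameConnection (i : Fin 3) : SmoothM (frameConnection G F N i) U :=
  (h.smooth_frameM.transpose.mul h.smooth_metric_comp).mul (h.smooth_covFrame i)

lemma smooth_chartExtrinsic (i j : Fin 3) : ContDiffOn ℝ ∞ (chartExtrinsic G F N i j) U :=
  (h.smooth_frameConnection i j.succ 0).neg

lemma pdM_metric_comp (hx : x ∈ U) (i : Fin 3) :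
    pdM i (fun z => G (F z)) x = G (F x) * pullbackConnection G F i x
      + (G (F x) * pullbackConnection G F i x)ᵀ := by
  have h1 : pdM i (fun z => G (F z)) x = ∑ α, pd i (fun w => F w α) x • pdM α G (F x) := by
    ext b c
    have := pd_comp (f := fun w => G w b c) i
      (h.smooth_metric.diffAt h.isOpen_W (h.mapsTo x hx) b c)
      (ContDiffOn.diffAt h.isOpen_U h.smooth_map hx)
    simp only [pdM, Matrix.of_apply, this, Matrix.sum_apply, Matrix.smul_apply, smul_eq_mul,
      mul_comm]
  rw [h1, pullbackConnection, Finset.mul_sum, Matrix.transpose_sum, ← Finset.sum_add_distrib]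
  refine Finset.sum_congr rfl fun β _ => ?_
  rw [pdM_metric h.isOpen_W h.symm_metric (h.mapsTo x hx) (h.det_metric _ (h.mapsTo x hx)),
    smul_add, Matrix.mul_smul, Matrix.transpose_smul]

/-- The Gram matrix of the frame is constant, and the connection is metric: the derivative of `Eᵀ G
E` is the connection matrix plus its transpose. -/
lemma frameConnection_antisymm (hx : x ∈ U) (i : Fin 3) (a b : Fin 4) :
    frameConnection G F N i x a b = -frameConnection G F N i x b a := by
  have hE := h.smooth_frameM
  have h0 : pdM i (fun z => (frameM F N z)ᵀ * G (F z) * frameM F N z) x = 0 := by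
    rw [pdM_congr_on h.isOpen_U h.orthonormal hx]
    ext a b
    exact pd_const i _
  rw [pdM_mul (hE.transpose.mul h.smooth_metric_comp) hE h.isOpen_U hx,
    pdM_mul hE.transpose h.smooth_metric_comp h.isOpen_U hx, pdM_transpose,
    h.pdM_metric_comp hx] at h0
  have h1 : frameConnection G F N i x + (frameConnection G F N i x)ᵀ = 0 := by
    rw [← h0]
    simp only [frameConnection, covFrame, Matrix.transpose_add, Matrix.transpose_mul,
      h.symm_metric _ (h.mapsTo x hx), Matrix.mul_add, Matrix.add_mul, Matrix.mul_assoc,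
      Matrix.transpose_transpose]
    abel
  have h2 := congrFun (congrFun h1 a) b
  simp only [Matrix.add_apply, Matrix.transpose_apply, Matrix.zero_apply] at h2
  linarith

lemma frameConnection_diag (hx : x ∈ U) (i : Fin 3) (a : Fin 4) :
    frameConnection G F N i x a a = 0 := by
  linarith [h.frameConnection_antisymm hx i a a]

/-- Absence of torsion, `∇_i ∂_j F = ∇_j ∂_i F`: partial derivatives of `F` commute and the
Christoffel symbols are symmetric. -/
lemma covFrame_symm (hx : x ∈ U) (i j : Fin 3) (μ : Fin 4) :
    covFrame G F N i x μ j.succ = covFrame G F N j x μ i.succ := by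
  have h1 : pdM i (frameM F N) x μ j.succ = pdM j (frameM F N) x μ i.succ :=
    pd_comm h.isOpen_U (h.smooth_coord μ) hx i j
  have h2 : ∀ (β : Fin 4) (k : Fin 3), frameM F N x β k.succ = pd k (fun w => F w β) x :=
    fun _ _ => rfl
  simp only [covFrame, Matrix.add_apply, h1, Matrix.mul_apply, h2, pullbackConnection,
    Matrix.sum_apply, Matrix.smul_apply, smul_eq_mul, Finset.sum_mul, gammaM, Matrix.of_apply]
  congr 1
  rw [Finset.sum_comm]
  refine Finset.sum_congr rfl fun a _ => Finset.sum_congr rfl fun b _ => ?_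
  rw [christoffel_symm h.isOpen_W h.symm_metric (h.mapsTo x hx) μ a b]
  ring

lemma frameConnection_symm (hx : x ∈ U) (i j : Fin 3) (a : Fin 4) :
    frameConnection G F N i x a j.succ = frameConnection G F N j x a i.succ := by
  rw [frameConnection, Matrix.mul_apply, frameConnection, Matrix.mul_apply]
  simp only [h.covFrame_symm hx i j]

/-- The induced metric is flat, in Cartesian coordinates. -/
lemma frameConnection_spatial (hx : x ∈ U) (i j k : Fin 3) :
    frameConnection G F N i x k.succ j.succ = 0 := by
  have s := h.frameConnection_symm hx
  have a := h.frameConnection_antisymm hx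
  -- Symmetric in one pair of indices and antisymmetric in an overlapping pair: six alternating
  -- exchanges return the coefficient to its negative.
  linarith [s i j k.succ, a j k.succ i.succ, s j k i.succ, a k i.succ j.succ, s k i j.succ,
    a i j.succ k.succ]

lemma chartExtrinsic_symm (hx : x ∈ U) (i j : Fin 3) :
    chartExtrinsic G F N i j x = chartExtrinsic G F N j i x := by
  simp only [chartExtrinsic]
  rw [h.frameConnection_antisymm hx i, h.frameConnection_antisymm hx j,
    h.frameConnection_symm hx i j]

/-- Completeness of the frame: orthonormality exhibits a one-sided inverse of a square matrix, which
is then two-sided. It permits any vector to be expanded in the frame. -/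
lemma frame_complete (hx : x ∈ U) :
    frameM F N x * Matrix.diagonal minkowski * ((frameM F N x)ᵀ * G (F x)) = 1 := by
  have hη : Matrix.diagonal minkowski * Matrix.diagonal minkowski
      = (1 : Matrix (Fin 4) (Fin 4) ℝ) := by
    rw [Matrix.diagonal_mul_diagonal, ← Matrix.diagonal_one]
    congr 1
    ext a
    fin_cases a <;> simp [minkowski]
  rw [Matrix.mul_assoc]
  refine mul_eq_one_comm.1 ?_
  rw [Matrix.mul_assoc, h.orthonormal x hx, hη]

lemma covFrame_eq (hx : x ∈ U) (i : Fin 3) :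
    covFrame G F N i x = frameM F N x * Matrix.diagonal minkowski * frameConnection G F N i x := by
  rw [frameConnection, ← Matrix.mul_assoc, h.frame_complete hx, Matrix.one_mul]

/-- The curvature of the pulled back connection. -/
lemma pullback_curvature (hx : x ∈ U) (i j : Fin 3) :
    pdM i (pullbackConnection G F j) x - pdM j (pullbackConnection G F i) x
      + (pullbackConnection G F i x * pullbackConnection G F j x
        - pullbackConnection G F j x * pullbackConnection G F i x)
      = ∑ m, ∑ n, (pd i (fun w => F w m) x * pd j (fun w => F w n) x) • curvM G m n (F x) := by
  have hΓ := smoothM_gammaM h.isOpen_W h.smooth_metric h.det_metric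
  have h1 : ∀ a b, pdM a (pullbackConnection G F b) x
      = ∑ n, pd a (pd b (fun w => F w n)) x • gammaM G n (F x)
        + ∑ m, ∑ n, (pd a (fun w => F w m) x * pd b (fun w => F w n) x) •
            pdM m (gammaM G n) (F x) := by
    intro a b
    ext c d
    have hd1 : ∀ n, DifferentiableAt ℝ (pd b (fun w => F w n)) x := fun n =>
      ContDiffOn.diffAt h.isOpen_U (contDiffOn_pd h.isOpen_U (h.smooth_coord n) b) hx
    have hd2 : ∀ n, DifferentiableAt ℝ (fun z => gammaM G n (F z) c d) x := fun n =>
      ((hΓ n).diffAt h.isOpen_W (h.mapsTo x hx) c d).comp x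
        (ContDiffOn.diffAt h.isOpen_U h.smooth_map hx)
    have h2 : ∀ n, pd a (fun z => gammaM G n (F z) c d) x
        = ∑ m, pd m (fun y => gammaM G n y c d) (F x) * pd a (fun w => F w m) x := fun n =>
      pd_comp (f := fun y => gammaM G n y c d) a ((hΓ n).diffAt h.isOpen_W (h.mapsTo x hx) c d)
        (ContDiffOn.diffAt h.isOpen_U h.smooth_map hx)
    simp only [pdM, Matrix.of_apply, pullbackConnection, Matrix.sum_apply, Matrix.smul_apply,
      smul_eq_mul, Matrix.add_apply]
    rw [pd_sum (f := fun n z => pd b (fun w => F w n) z * gammaM G n (F z) c d) _ _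
      fun n _ => (hd1 n).mul (hd2 n)]
    rw [Finset.sum_comm (γ := Fin 4), ← Finset.sum_add_distrib]
    refine Finset.sum_congr rfl fun n _ => ?_
    rw [pd_mul a (hd1 n) (hd2 n), h2, Finset.mul_sum]
    congr 1
    exact Finset.sum_congr rfl fun m _ => by ring
  have h3 : ∀ a b, pullbackConnection G F a x * pullbackConnection G F b x
      = ∑ m, ∑ n, (pd a (fun w => F w m) x * pd b (fun w => F w n) x) •
          (gammaM G m (F x) * gammaM G n (F x)) := by
    intro a b
    simp only [pullbackConnection, Finset.sum_mul, Finset.mul_sum, Matrix.smul_mul,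
      Matrix.mul_smul, smul_smul]
    rw [Finset.sum_comm]
    exact Finset.sum_congr rfl fun m _ => Finset.sum_congr rfl fun n _ => by rw [mul_comm]
  rw [h1, h1, h3, h3]
  -- The terms with second derivatives of `F` are symmetric in `i`, `j` and cancel, leaving only the
  -- curvature.
  have h4 : ∀ n, pd i (pd j (fun w => F w n)) x = pd j (pd i (fun w => F w n)) x := fun n =>
    pd_comm h.isOpen_U (h.smooth_coord n) hx i j
  simp only [h4, curvM, smul_add, smul_sub, Finset.sum_add_distrib, Finset.sum_sub_distrib]
  rw [Finset.sum_comm (f := fun m n => (pd j (fun w => F w m) x * pd i (fun w => F w n) x) •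
      pdM m (gammaM G n) (F x)),
    Finset.sum_comm (f := fun m n => (pd j (fun w => F w m) x * pd i (fun w => F w n) x) •
      (gammaM G m (F x) * gammaM G n (F x)))]
  simp only [mul_comm (pd j _ x)]
  abel

/-- The Ricci identity for the frame, in components. -/
lemma pdM_frameConnection_sub (hx : x ∈ U) (i j : Fin 3) :
    pdM i (frameConnection G F N j) x - pdM j (frameConnection G F N i) x
      = (frameM F N x)ᵀ * G (F x) *
          (∑ m, ∑ n, (pd i (fun w => F w m) x * pd j (fun w => F w n) x) • curvM G m n (F x)) *
          frameM F N x
        + ((covFrame G F N i x)ᵀ * G (F x) * covFrame G F N j x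
          - (covFrame G F N j x)ᵀ * G (F x) * covFrame G F N i x) := by
  have hE := h.smooth_frameM
  have hω := h.smooth_pullbackConnection
  have hU := h.isOpen_U
  -- Metric compatibility lets the derivative of `Eᵀ G` be completed to a covariant one. What
  -- remains is a second covariant derivative of `E`, whose antisymmetrization is the curvature.
  have h1 : ∀ a b, pdM a (frameConnection G F N b) x
      = (covFrame G F N a x)ᵀ * G (F x) * covFrame G F N b x
        + (frameM F N x)ᵀ * G (F x) * (pdM a (pdM b (frameM F N)) x
          + (pdM a (pullbackConnection G F b) x * frameM F N x
            + pullbackConnection G F b x * pdM a (frameM F N) x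
            + pullbackConnection G F a x * covFrame G F N b x)) := by
    intro a b
    have e1 : pdM a (frameConnection G F N b) x = _ :=
      pdM_mul (hE.transpose.mul h.smooth_metric_comp) (h.smooth_covFrame b) hU hx a
    have e2 : pdM a (covFrame G F N b) x = _ :=
      pdM_add (hE.pdM hU b) ((hω b).mul hE) hU hx a
    rw [e1, pdM_mul hE.transpose h.smooth_metric_comp hU hx, pdM_transpose, h.pdM_metric_comp hx,
      e2, pdM_mul (hω b) hE hU hx]
    simp only [covFrame, Matrix.transpose_add, Matrix.transpose_mul,
      h.symm_metric _ (h.mapsTo x hx), Matrix.mul_add, Matrix.add_mul, Matrix.mul_assoc]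
    abel
  rw [h1, h1, ← h.pullback_curvature hx, pdM_comm hE hU hx i j]
  simp only [covFrame, Matrix.mul_add, Matrix.add_mul, Matrix.mul_sub, Matrix.sub_mul,
    Matrix.mul_assoc]
  abel

/-- The equation of Codazzi. -/
lemma codazzi (hx : x ∈ U) (i j k : Fin 3) :
    ((frameM F N x)ᵀ * G (F x) *
      (∑ m, ∑ n, (pd i (fun w => F w m) x * pd j (fun w => F w n) x) • curvM G m n (F x)) *
      frameM F N x) k.succ 0
      = pd j (chartExtrinsic G F N i k) x - pd i (chartExtrinsic G F N j k) x := by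
  have h1 := congrFun (congrFun (h.pdM_frameConnection_sub hx i j) k.succ) 0
  -- In the frame the quadratic term is `∑ c, η_c ω_a(c,k) ω_b(c,0)`. For `c = 0` the second factor
  -- is a diagonal entry, for spatial `c` the first one vanishes by flatness.
  have h2 : ∀ a b, ((covFrame G F N a x)ᵀ * G (F x) * covFrame G F N b x) k.succ 0 = 0 := by
    intro a b
    have e : (covFrame G F N a x)ᵀ * G (F x) * covFrame G F N b x
        = (frameConnection G F N a x)ᵀ * (Matrix.diagonal minkowski * frameConnection G F N b x) := by
      conv_lhs => rw [h.covFrame_eq hx a]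
      simp only [frameConnection, Matrix.transpose_mul, Matrix.diagonal_transpose, Matrix.mul_assoc]
    rw [e, Matrix.mul_apply, Fin.sum_univ_succ]
    simp only [Matrix.diagonal_mul, Matrix.transpose_apply, h.frameConnection_diag hx,
      h.frameConnection_spatial hx]
    simp
  simp only [Matrix.sub_apply, Matrix.add_apply, h2, sub_self, add_zero] at h1
  rw [← h1]
  have h3 : ∀ a b, pd a (chartExtrinsic G F N b k) x
      = -pdM a (frameConnection G F N b) x k.succ 0 := fun a b => pd_neg a
  rw [h3, h3]
  ring

/-- Congruence preserves antisymmetry, and an antisymmetric matrix has zero diagonal. This supplies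
the normal-normal entry in the trace of the Codazzi equation. -/
lemma curvature_diag (hx : x ∈ U) (m n a : Fin 4) :
    ((frameM F N x)ᵀ * (G (F x) * curvM G m n (F x)) * frameM F N x) a a = 0 := by
  have h1 := metric_mul_curvM_antisymm h.isOpen_W h.smooth_metric h.symm_metric h.det_metric
    (h.mapsTo x hx) m n
  set C := G (F x) * curvM G m n (F x)
  have h2 : (frameM F N x)ᵀ * C * frameM F N x + ((frameM F N x)ᵀ * C * frameM F N x)ᵀ = 0 := by
    have : (frameM F N x)ᵀ * (C + Cᵀ) * frameM F N x = 0 := by rw [h1]; simp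
    rw [← this]
    simp only [Matrix.transpose_mul, Matrix.transpose_transpose, Matrix.mul_add, Matrix.add_mul,
      Matrix.mul_assoc]
  have h3 := congrFun (congrFun h2 a) a
  simp only [Matrix.add_apply, Matrix.transpose_apply, Matrix.zero_apply] at h3
  linarith

lemma orthonormal_apply (hx : x ∈ U) (a b : Fin 4) :
    ∑ α, ∑ β, G (F x) α β * frameM F N x α a * frameM F N x β b
      = Matrix.diagonal minkowski a b := by
  rw [← h.orthonormal x hx, Matrix.mul_assoc, Matrix.mul_apply]
  refine Finset.sum_congr rfl fun α _ => ?_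
  rw [Matrix.mul_apply, Finset.mul_sum]
  exact Finset.sum_congr rfl fun β _ => by rw [Matrix.transpose_apply]; ring

/-- The momentum constraint. -/
lemma momentum_constraint (hx : x ∈ U) {c : ℝ}
    (hric : ∀ s n, ricci G (F x) s n = c * G (F x) s n) (j : Fin 3) :
    ∑ k, pd k (chartExtrinsic G F N j k) x = ∑ k, pd j (chartExtrinsic G F N k k) x := by
  set E := frameM F N x with hE
  set P := E.transpose * G (F x) with hP
  have hc : ∀ k : Fin 3, pd j (chartExtrinsic G F N k k) x - pd k (chartExtrinsic G F N j k) x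
      = ∑ m, ∑ n, E m k.succ * E n j.succ * (P * curvM G m n (F x) * E) k.succ 0 := by
    intro k
    rw [← h.codazzi hx k j k]
    simp only [← hE, ← hP, Finset.mul_sum, Finset.sum_mul, Matrix.mul_smul, Matrix.smul_mul,
      Matrix.sum_apply, Matrix.smul_apply, smul_eq_mul]
    rfl
  have h0 : ∀ m n, (P * curvM G m n (F x) * E) 0 0 = 0 := by
    intro m n
    have := h.curvature_diag hx m n 0
    rwa [← Matrix.mul_assoc] at this
  -- The term `a = 0` is zero by `h0`, so the spatial trace of the Codazzi equation is already the
  -- full trace with respect to `η`.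
  have h1 : ∑ a, ∑ m, ∑ n, minkowski a * (E m a * E n j.succ * (P * curvM G m n (F x) * E) a 0)
      = ∑ k : Fin 3, (pd j (chartExtrinsic G F N k k) x - pd k (chartExtrinsic G F N j k) x) := by
    rw [Fin.sum_univ_succ]
    have hm : ∀ k : Fin 3, minkowski k.succ = 1 := by intro k; fin_cases k <;> simp [minkowski]
    simp only [h0, hc, hm, one_mul, mul_zero, Finset.sum_const_zero, zero_add]
  -- Completeness of the frame turns the `η`-trace into the coordinate contraction of the upper
  -- index with `m`, that is, into a Ricci component.
  have h2 : ∀ m n, ∑ a, minkowski a * (E m a * E n j.succ * (P * curvM G m n (F x) * E) a 0)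
      = E n j.succ * (curvM G m n (F x) * E) m 0 := by
    intro m n
    have e : (curvM G m n (F x) * E) m 0
        = (E * Matrix.diagonal minkowski * P * (curvM G m n (F x) * E)) m 0 := by
      rw [hP, h.frame_complete hx, Matrix.one_mul]
    rw [e, Matrix.mul_assoc _ P, Matrix.mul_apply, Finset.mul_sum]
    refine Finset.sum_congr rfl fun a _ => ?_
    rw [Matrix.mul_diagonal, Matrix.mul_assoc P]
    ring
  have h3 : ∑ a, ∑ m, ∑ n, minkowski a * (E m a * E n j.succ * (P * curvM G m n (F x) * E) a 0)
      = 0 := by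
    rw [Finset.sum_comm]
    calc _ = ∑ m, ∑ n, E n j.succ * (curvM G m n (F x) * E) m 0 := by
          refine Finset.sum_congr rfl fun m _ => ?_
          rw [Finset.sum_comm]
          exact Finset.sum_congr rfl fun n _ => h2 m n
      _ = ∑ n, ∑ s, E n j.succ * (ricci G (F x) s n * E s 0) := by
          rw [Finset.sum_comm]
          refine Finset.sum_congr rfl fun n _ => ?_
          simp only [Matrix.mul_apply, ← riemannUp_eq_curvM, Finset.mul_sum, ricci, Finset.sum_mul]
          rw [Finset.sum_comm]
      _ = c * ∑ s, ∑ n, G (F x) s n * E s 0 * E n j.succ := by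
          rw [Finset.sum_comm]
          simp only [hric, Finset.mul_sum]
          exact Finset.sum_congr rfl fun s _ => Finset.sum_congr rfl fun n _ => by ring
      -- Since Ricci is `c G` at this point, the contraction is `c g(n, ∂_j)`, and the normal is
      -- orthogonal to the surface.
      _ = 0 := by
          rw [h.orthonormal_apply hx]
          simp [(Fin.succ_ne_zero j).symm]
  rw [h1, Finset.sum_sub_distrib] at h3
  linarith

/-- The mixed components of the Weyl tensor of an Einstein metric along the hypersurface. -/
lemma weyl_mixed (hx : x ∈ U) {c : ℝ}
    (hric : ∀ s n, ricci G (F x) s n = c * G (F x) s n) (i l s : Fin 3) :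
    ∑ α, ∑ β, ∑ μ, ∑ ν, weyl G (F x) α β μ ν * frameM F N x α i.succ * frameM F N x β 0
        * frameM F N x μ l.succ * frameM F N x ν s.succ
      = pd s (chartExtrinsic G F N l i) x - pd l (chartExtrinsic G F N s i) x := by
  rw [← h.codazzi hx l s i]
  set E := frameM F N x with hE
  -- The two Ricci terms of the Weyl tensor coincide when Ricci is `c G` and together contribute
  -- `-c`.
  set κ : ℝ := (1 / 6) * scalarCurvature G (F x) - c with hκ
  have hw : ∀ α β μ ν, weyl G (F x) α β μ ν = riemann G (F x) α β μ ν
      + κ * (G (F x) α μ * G (F x) ν β - G (F x) α ν * G (F x) μ β) := by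
    intro α β μ ν
    have hs : ∀ a b, G (F x) a b = G (F x) b a := fun a b =>
      congrFun (congrFun (h.symm_metric _ (h.mapsTo x hx)) b) a
    simp only [weyl, hric, hκ, hs β μ, hs β ν, hs ν α, hs μ α]
    ring
  -- With a single normal index, every product `g g` contains a factor `g(∂_a, n) = 0`, so the `κ`
  -- term is invisible.
  have hG : ∀ a : Fin 3, ∑ α, ∑ β, G (F x) α β * E α a.succ * E β 0 = 0 := fun a => by
    rw [h.orthonormal_apply hx]
    simp
  have e1 : ∀ a b : Fin 3, ∑ α, ∑ β, ∑ μ, ∑ ν, (G (F x) α μ * G (F x) ν β) * E α i.succ * E β 0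
        * E μ a.succ * E ν b.succ = 0 := by
    intro a b
    calc _ = (∑ α, ∑ μ, G (F x) α μ * E α i.succ * E μ a.succ)
          * ∑ ν, ∑ β, G (F x) ν β * E ν b.succ * E β 0 := by
          simp only [Finset.sum_mul]
          refine Finset.sum_congr rfl fun α _ => ?_
          rw [sum_rotate]
          refine Finset.sum_congr rfl fun μ _ => ?_
          simp only [Finset.mul_sum]
          exact Finset.sum_congr rfl fun ν _ => Finset.sum_congr rfl fun β _ => by ring
      _ = 0 := by rw [hG, mul_zero]
  have e2 : ∑ α, ∑ β, ∑ μ, ∑ ν, (G (F x) α ν * G (F x) μ β) * E α i.succ * E β 0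
        * E μ l.succ * E ν s.succ = 0 := by
    rw [← e1 s l]
    refine Finset.sum_congr rfl fun α _ => Finset.sum_congr rfl fun β _ => ?_
    rw [Finset.sum_comm]
    exact Finset.sum_congr rfl fun μ _ => Finset.sum_congr rfl fun ν _ => by ring
  have e3 : ∑ α, ∑ β, ∑ μ, ∑ ν, weyl G (F x) α β μ ν * E α i.succ * E β 0
        * E μ l.succ * E ν s.succ
      = ∑ α, ∑ β, ∑ μ, ∑ ν, riemann G (F x) α β μ ν * E α i.succ * E β 0
        * E μ l.succ * E ν s.succ := by
    have e : ∀ S₁ S₂ T T' : ℝ, S₁ = 0 → S₂ = 0 → T = T' + κ * (S₁ - S₂) → T = T' := by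
      intro S₁ S₂ T T' h₁ h₂ h₃
      rw [h₃, h₁, h₂]; ring
    refine e _ _ _ _ (e1 l s) e2 ?_
    simp only [← Finset.sum_sub_distrib, Finset.mul_sum, ← Finset.sum_add_distrib, hw]
    refine Finset.sum_congr rfl fun α _ => Finset.sum_congr rfl fun β _ =>
      Finset.sum_congr rfl fun μ _ => Finset.sum_congr rfl fun ν _ => by ring
  rw [e3]
  have hpd : ∀ (k : Fin 3) (m : Fin 4), pd k (fun w => F w m) x = E m k.succ := fun _ _ => rfl
  have e4 : Eᵀ * G (F x) * (∑ m, ∑ n, (pd l (fun w => F w m) x * pd s (fun w => F w n) x)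
        • curvM G m n (F x)) * E
      = ∑ m, ∑ n, (E m l.succ * E n s.succ) • (Eᵀ * (G (F x) * curvM G m n (F x)) * E) := by
    simp only [hpd, Finset.mul_sum, Finset.sum_mul, Matrix.mul_smul, Matrix.smul_mul,
      Matrix.mul_assoc]
  rw [e4]
  have e5 : ∀ (C : Matrix (Fin 4) (Fin 4) ℝ), (Eᵀ * C * E) i.succ 0
      = ∑ α, ∑ β, C α β * E α i.succ * E β 0 := by
    intro C
    rw [Matrix.mul_assoc, Matrix.mul_apply]
    refine Finset.sum_congr rfl fun α _ => ?_
    rw [Matrix.mul_apply, Finset.mul_sum]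
    exact Finset.sum_congr rfl fun β _ => by rw [Matrix.transpose_apply]; ring
  simp only [Matrix.sum_apply, Matrix.smul_apply, smul_eq_mul, e5, Finset.mul_sum,
    riemann_eq_curvM]
  calc _ = ∑ α, ∑ m, ∑ n, ∑ β, (G (F x) * curvM G m n (F x)) α β * E α i.succ * E β 0
        * E m l.succ * E n s.succ := Finset.sum_congr rfl fun α _ => sum_rotate _
    _ = ∑ m, ∑ n, ∑ α, ∑ β, (G (F x) * curvM G m n (F x)) α β * E α i.succ * E β 0
        * E m l.succ * E n s.succ := sum_rotate _
    _ = _ := Finset.sum_congr rfl fun m _ => Finset.sum_congr rfl fun n _ =>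
      Finset.sum_congr rfl fun α _ => Finset.sum_congr rfl fun β _ => by ring

end IsFlatInChart

/-- The trace of Einstein's vacuum equations. -/
lemma ricci_eq_of_vacuum {y : E4} {Λ : ℝ} (hvac : ∀ μ ν, ricci G y μ ν
      - (1 / 2) * scalarCurvature G y * G y μ ν + Λ * G y μ ν = 0) (μ ν : Fin 4) :
    ricci G y μ ν = ((1 / 2) * scalarCurvature G y - Λ) * G y μ ν := by
  linarith [hvac μ ν]

end Chart

/-! ### Charts of spacetime -/

section ExtChart

variable {d : ℕ} {M : Type*} [TopologicalSpace M] [ChartedSpace (EuclideanSpace ℝ (Fin d)) M]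
  [IsManifold (𝓡 d) ∞ M] {p : M} {y : EuclideanSpace ℝ (Fin d)}

lemma mdifferentiableAt_extChartAt_symm (hy : y ∈ (extChartAt (𝓡 d) p).target) :
    MDifferentiableAt 𝓘(ℝ, EuclideanSpace ℝ (Fin d)) (𝓡 d) (extChartAt (𝓡 d) p).symm y := by
  have := mdifferentiableWithinAt_extChartAt_symm (I := 𝓡 d) hy
  rwa [ModelWithCorners.range_eq_univ, mdifferentiableWithinAt_univ] at this

lemma mdifferentiableAt_extChartAt_of_mem {q : M} (hq : q ∈ (extChartAt (𝓡 d) p).source) :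
    MDifferentiableAt (𝓡 d) 𝓘(ℝ, EuclideanSpace ℝ (Fin d)) (extChartAt (𝓡 d) p) q :=
  mdifferentiableAt_extChartAt (by rwa [extChartAt_source] at hq)

lemma mfderiv_symm_comp_mfderiv_extChartAt (hy : y ∈ (extChartAt (𝓡 d) p).target)
    (v : TangentSpace (𝓡 d) ((extChartAt (𝓡 d) p).symm y)) :
    mfderiv 𝓘(ℝ, EuclideanSpace ℝ (Fin d)) (𝓡 d) (extChartAt (𝓡 d) p).symm y
      (mfderiv (𝓡 d) 𝓘(ℝ, EuclideanSpace ℝ (Fin d)) (extChartAt (𝓡 d) p)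
        ((extChartAt (𝓡 d) p).symm y) v) = v := by
  have := mfderivWithin_extChartAt_symm_comp_mfderiv_extChartAt (I := 𝓡 d) hy
  rw [ModelWithCorners.range_eq_univ, mfderivWithin_univ] at this
  exact DFunLike.congr_fun this v

lemma mfderiv_extChartAt_comp_mfderiv_symm (hy : y ∈ (extChartAt (𝓡 d) p).target)
    (v : EuclideanSpace ℝ (Fin d)) :
    mfderiv (𝓡 d) 𝓘(ℝ, EuclideanSpace ℝ (Fin d)) (extChartAt (𝓡 d) p)
        ((extChartAt (𝓡 d) p).symm y)
      (mfderiv 𝓘(ℝ, EuclideanSpace ℝ (Fin d)) (𝓡 d) (extChartAt (𝓡 d) p).symm y v) = v := by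
  have := mfderiv_extChartAt_comp_mfderivWithin_extChartAt_symm (I := 𝓡 d) hy
  rw [ModelWithCorners.range_eq_univ, mfderivWithin_univ] at this
  exact DFunLike.congr_fun this v

/-- The change of coordinates from the chart at `q` to the chart at `p`. -/
def transition (p q : M) (y : EuclideanSpace ℝ (Fin d)) :
    EuclideanSpace ℝ (Fin d) := extChartAt (𝓡 d) p ((extChartAt (𝓡 d) q).symm y)

/-- The domain of the change of coordinates. -/
def transitionDom (d : ℕ) {M : Type*} [TopologicalSpace M]
    [ChartedSpace (EuclideanSpace ℝ (Fin d)) M] (p q : M) : Set (EuclideanSpace ℝ (Fin d)) :=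
  (extChartAt (𝓡 d) q).target ∩ (extChartAt (𝓡 d) q).symm ⁻¹' (extChartAt (𝓡 d) p).source

/-- The Jacobian matrix of the change of coordinates. -/
def transitionJacobian (p q : M) (y : EuclideanSpace ℝ (Fin d)) :
    Matrix (Fin d) (Fin d) ℝ :=
  Matrix.of fun μ α => pd α (fun w => transition p q w μ) y

lemma isOpen_transitionDom (p q : M) : IsOpen (transitionDom d p q) :=
  (contMDiffOn_extChartAt_symm (I := 𝓡 d) (n := ∞) q).continuousOn.isOpen_inter_preimage
    (isOpen_extChartAt_target q) (isOpen_extChartAt_source p)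

lemma contDiffOn_transition (p q : M) : ContDiffOn ℝ ∞ (transition p q) (transitionDom d p q) := by
  have h : ContMDiffOn (𝓡 d) 𝓘(ℝ, EuclideanSpace ℝ (Fin d)) ∞ (extChartAt (𝓡 d) p)
      (extChartAt (𝓡 d) p).source := by
    rw [extChartAt_source]; exact contMDiffOn_extChartAt
  exact (h.comp ((contMDiffOn_extChartAt_symm (I := 𝓡 d) (n := ∞) q).mono Set.inter_subset_left)
    fun z hz => hz.2).contDiffOn

end ExtChart

/-! ### The metric, the frame and the hypersurface read in charts of spacetime. -/

section Spacetime

variable {M : Type*} [TopologicalSpace M] [ChartedSpace E4 M] [IsManifold (𝓡 4) ∞ M]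
  {g : LorentzMetric M} {p q : M}

/-- The metric in terms of its components in a chart. -/
lemma LorentzMetric.val_eq_inChart (g : LorentzMetric M)
    (hq : q ∈ (extChartAt (𝓡 4) p).source) (v w : TangentSpace (𝓡 4) q) {v' w' : E4}
    (hv : mfderiv (𝓡 4) 𝓘(ℝ, E4) (extChartAt (𝓡 4) p) q v = v')
    (hw : mfderiv (𝓡 4) 𝓘(ℝ, E4) (extChartAt (𝓡 4) p) q w = w') :
    g.val q v w = ∑ μ, ∑ ν, g.inChart p (extChartAt (𝓡 4) p q) μ ν * v' μ * w' ν := by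
  obtain ⟨y, hy, rfl⟩ : ∃ y ∈ (extChartAt (𝓡 4) p).target, (extChartAt (𝓡 4) p).symm y = q :=
    ⟨_, (extChartAt (𝓡 4) p).map_source hq, (extChartAt (𝓡 4) p).left_inv hq⟩
  rw [(extChartAt (𝓡 4) p).right_inv hy]
  have key : ∀ (u : TangentSpace (𝓡 4) ((extChartAt (𝓡 4) p).symm y)) (u' : E4),
      mfderiv (𝓡 4) 𝓘(ℝ, E4) (extChartAt (𝓡 4) p) ((extChartAt (𝓡 4) p).symm y) u = u' →
      u = ∑ μ, u' μ • mfderiv 𝓘(ℝ, E4) (𝓡 4) (extChartAt (𝓡 4) p).symm y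
        (EuclideanSpace.single μ (1 : ℝ)) := by
    intro u u' hu
    have e : u' = ∑ a, u' a • EuclideanSpace.single a (1 : ℝ) := by
      ext b
      simp [Pi.single_apply]
    conv_lhs => rw [← mfderiv_symm_comp_mfderiv_extChartAt hy u, hu, e]
    exact (map_sum _ _ _).trans (Finset.sum_congr rfl fun μ _ => map_smul _ _ _)
  rw [key v v' hv, key w w' hw]
  simp only [map_sum, map_smul, _root_.sum_apply, _root_.smul_apply,
    smul_eq_mul, Finset.mul_sum, LorentzMetric.inChart, Matrix.of_apply]
  rw [Finset.sum_comm]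
  exact Finset.sum_congr rfl fun μ _ => Finset.sum_congr rfl fun ν _ => by ring

lemma LorentzMetric.inChart_symm (g : LorentzMetric M) (p : M) (y : E4) :
    (g.inChart p y)ᵀ = g.inChart p y := by
  ext μ ν
  exact g.symm _ _ _

/-- Pairing with a basis vector of the pseudo-orthonormal basis isolates one coefficient up to a
sign. -/
lemma LorentzMetric.eq_zero_of_forall (g : LorentzMetric M) (v : TangentSpace (𝓡 4) p)
    (h : ∀ w, g.val p v w = 0) : v = 0 := by
  obtain ⟨b, hb⟩ := g.signature p
  have hm : ∀ i, minkowski i ≠ 0 := by intro i; fin_cases i <;> simp [minkowski]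
  rw [← b.sum_repr v] at h ⊢
  have h0 : ∀ j, b.repr v j = 0 := by
    intro j
    have := h (b j)
    simp only [map_sum, map_smul, _root_.sum_apply, _root_.smul_apply,
      smul_eq_mul, hb, mul_ite, mul_zero, Finset.sum_ite_eq', Finset.mem_univ, if_true] at this
    exact (mul_eq_zero.1 this).resolve_right (hm j)
  simp [h0]

/-- A null vector of the component matrix would be the coordinate vector of a nonzero tangent vector
orthogonal to everything. -/
lemma LorentzMetric.isUnit_det_inChart (g : LorentzMetric M) {y : E4}
    (hy : y ∈ (extChartAt (𝓡 4) p).target) : IsUnit (g.inChart p y).det := by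
  rw [isUnit_iff_ne_zero]
  intro h0
  obtain ⟨v, hv0, hv⟩ := Matrix.exists_vecMul_eq_zero_iff.2 h0
  set u : TangentSpace (𝓡 4) ((extChartAt (𝓡 4) p).symm y) :=
    mfderiv 𝓘(ℝ, E4) (𝓡 4) (extChartAt (𝓡 4) p).symm y (WithLp.toLp 2 v : E4) with hu
  have hu' := mfderiv_extChartAt_comp_mfderiv_symm hy (WithLp.toLp 2 v : E4)
  have h1 : u = 0 := by
    refine g.eq_zero_of_forall u fun w => ?_
    rw [g.val_eq_inChart ((extChartAt (𝓡 4) p).map_target hy) u w hu' rfl,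
      (extChartAt (𝓡 4) p).right_inv hy, Finset.sum_comm]
    refine Finset.sum_eq_zero fun ν _ => ?_
    have := congrFun hv ν
    simp only [Matrix.vecMul, dotProduct, Pi.zero_apply] at this
    rw [← Finset.sum_mul]
    have h2 : ∑ i, g.inChart p y i ν * v i = 0 := by
      rw [← this]; exact Finset.sum_congr rfl fun i _ => mul_comm _ _
    rw [h2, zero_mul]
  rw [← hu, h1, map_zero] at hu'
  exact hv0 (congrArg (WithLp.ofLp (p := 2) (V := Fin 4 → ℝ)) hu').symm

/-- The coordinate vector fields are smooth sections, being images of constant fields under the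
tangent map of the inverse chart; the metric is a smooth section applied to two of them. -/
lemma LorentzMetric.smoothM_inChart (g : LorentzMetric M) (p : M) :
    SmoothM (g.inChart p) (extChartAt (𝓡 4) p).target := by
  have hopen : IsOpen (extChartAt (𝓡 4) p).target := isOpen_extChartAt_target p
  have hs := contMDiffOn_extChartAt_symm (I := 𝓡 4) (n := ∞) p
  have hX : ∀ μ : Fin 4, ContMDiffOn 𝓘(ℝ, E4) (𝓡 4).tangent ∞
      (fun y => (⟨(extChartAt (𝓡 4) p).symm y, mfderiv 𝓘(ℝ, E4) (𝓡 4) (extChartAt (𝓡 4) p).symm y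
        (EuclideanSpace.single μ (1 : ℝ))⟩ : TangentBundle (𝓡 4) M))
      (extChartAt (𝓡 4) p).target := by
    intro μ
    have h1 := hs.contMDiffOn_tangentMapWithin (m := ∞) (by simp) hopen.uniqueMDiffOn
    have h2 : ContMDiffOn 𝓘(ℝ, E4) 𝓘(ℝ, E4).tangent ∞
        (fun y => (⟨y, EuclideanSpace.single μ (1 : ℝ)⟩ : TangentBundle 𝓘(ℝ, E4) E4))
        (extChartAt (𝓡 4) p).target := fun y _ =>
      contMDiffWithinAt_vectorSpace_iff_contDiffWithinAt.2 contDiffWithinAt_const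
    refine (h1.comp h2 fun y hy => hy).congr fun y hy => ?_
    simp only [Function.comp_apply, tangentMapWithin, mfderivWithin_of_isOpen hopen hy]
  intro μ ν y hy
  have h := ContMDiffWithinAt.clm_bundle_apply₂ (F₁ := E4) (F₂ := E4)
    (E₁ := fun p : M => TangentSpace (𝓡 4) p) (E₂ := fun p : M => TangentSpace (𝓡 4) p)
    (F₃ := ℝ) (E₃ := fun _ : M => ℝ)
    (g.contMDiff.contMDiffAt.comp_contMDiffWithinAt y (hs y hy)) (hX μ y hy) (hX ν y hy)
  simp only [contMDiffWithinAt_totalSpace] at h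
  exact h.2.contDiffWithinAt

namespace FlatHypersurface

variable (H : FlatHypersurface g) {x : E3}

/-- The part of the hypersurface in the chart at `p`. -/
def chartDom (p : M) : Set E3 := H.dom ∩ H.emb ⁻¹' (extChartAt (𝓡 4) p).source

/-- The hypersurface in the chart at `p`. -/
def chartEmb (p : M) (z : E3) : E4 := extChartAt (𝓡 4) p (H.emb z)

/-- The normal field in the chart at `p`. -/
def chartNormal (p : M) (z : E3) : Fin 4 → ℝ :=
  WithLp.ofLp (p := 2) (V := Fin 4 → ℝ)
    (mfderiv (𝓡 4) 𝓘(ℝ, E4) (extChartAt (𝓡 4) p) (H.emb z) (H.normal z))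

lemma isOpen_chartDom (p : M) : IsOpen (H.chartDom p) :=
  H.contMDiffOn_emb.continuousOn.isOpen_inter_preimage H.isOpen_dom (isOpen_extChartAt_source p)

lemma mem_chartDom_self (hx : x ∈ H.dom) : x ∈ H.chartDom (H.emb x) :=
  ⟨hx, mem_extChartAt_source _⟩

lemma contDiffOn_chartEmb (p : M) : ContDiffOn ℝ ∞ (H.chartEmb p) (H.chartDom p) := by
  have h : ContMDiffOn (𝓡 4) 𝓘(ℝ, E4) ∞ (extChartAt (𝓡 4) p) (extChartAt (𝓡 4) p).source := by
    rw [extChartAt_source]; exact contMDiffOn_extChartAt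
  exact (h.comp (H.contMDiffOn_emb.mono Set.inter_subset_left) fun z hz => hz.2).contDiffOn

lemma mdifferentiableAt_emb (hx : x ∈ H.dom) : MDifferentiableAt (𝓡 3) (𝓡 4) H.emb x :=
  (H.contMDiffOn_emb.contMDiffAt (H.isOpen_dom.mem_nhds hx)).mdifferentiableAt (by simp)

lemma mfderiv_extChartAt_emb (hx : x ∈ H.chartDom p) (u : E3) :
    mfderiv (𝓡 4) 𝓘(ℝ, E4) (extChartAt (𝓡 4) p) (H.emb x) (mfderiv (𝓡 3) (𝓡 4) H.emb x u)
      = fderiv ℝ (H.chartEmb p) x u := by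
  rw [← mfderiv_eq_fderiv]
  have := mfderiv_comp (I := 𝓡 3) (I' := 𝓡 4) (I'' := 𝓘(ℝ, E4)) x
    (mdifferentiableAt_extChartAt_of_mem hx.2) (H.mdifferentiableAt_emb hx.1)
  exact (DFunLike.congr_fun this u).symm

lemma mfderiv_extChartAt_tangent (hx : x ∈ H.chartDom p) (i : Fin 3) (μ : Fin 4) :
    WithLp.ofLp (p := 2) (V := Fin 4 → ℝ)
      (mfderiv (𝓡 4) 𝓘(ℝ, E4) (extChartAt (𝓡 4) p) (H.emb x) (H.tangent x i)) μ
      = pd i (fun z => H.chartEmb p z μ) x := by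
  have h := H.mfderiv_extChartAt_emb hx (EuclideanSpace.single i (1 : ℝ))
  exact (congrArg (fun v : E4 => v μ) h).trans (fderiv_apply_coord
    (ContDiffOn.diffAt (H.isOpen_chartDom p) (H.contDiffOn_chartEmb p) hx) _ μ)

lemma contDiffOn_chartNormal (p : M) (μ : Fin 4) :
    ContDiffOn ℝ ∞ (fun z => H.chartNormal p z μ) (H.chartDom p) := by
  have h : ContMDiffOn (𝓡 4) 𝓘(ℝ, E4) ∞ (extChartAt (𝓡 4) p) (extChartAt (𝓡 4) p).source := by
    rw [extChartAt_source]; exact contMDiffOn_extChartAt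
  have hopen : IsOpen (extChartAt (𝓡 4) p).source := isOpen_extChartAt_source p
  have h1 := h.contMDiffOn_tangentMapWithin (m := ∞) (by simp) hopen.uniqueMDiffOn
  have h2 := h1.comp (H.contMDiffOn_normal.mono (Set.inter_subset_left : H.chartDom p ⊆ _))
    fun z hz => hz.2
  have h3 := (contMDiff_snd_tangentBundle_modelSpace E4 𝓘(ℝ, E4) (n := ∞)).comp_contMDiffOn h2
  have h4 : ContDiffOn ℝ ∞ (fun z => (WithLp.toLp 2 (H.chartNormal p z) : E4)) (H.chartDom p) := by
    refine h3.contDiffOn.congr fun z hz => ?_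
    have e := mfderivWithin_of_isOpen (I := 𝓡 4) (I' := 𝓘(ℝ, E4)) (f := extChartAt (𝓡 4) p)
      hopen hz.2
    exact DFunLike.congr_fun e.symm (H.normal z)
  exact contDiffOn_euclidean.1 h4 μ

lemma mfderiv_extChartAt_frame (hx : x ∈ H.chartDom p) (a μ : Fin 4) :
    WithLp.ofLp (p := 2) (V := Fin 4 → ℝ)
      (mfderiv (𝓡 4) 𝓘(ℝ, E4) (extChartAt (𝓡 4) p) (H.emb x) (H.frame x a)) μ
      = frameM (H.chartEmb p) (H.chartNormal p) x μ a := by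
  refine Fin.cases rfl (fun i => ?_) a
  exact H.mfderiv_extChartAt_tangent hx i μ

lemma val_frame (hx : x ∈ H.dom) (a b : Fin 4) :
    g.val (H.emb x) (H.frame x a) (H.frame x b) = Matrix.diagonal minkowski a b := by
  have ht : ∀ i, H.frame x (Fin.succ i) = mfderiv (𝓡 3) (𝓡 4) H.emb x
    (EuclideanSpace.single i (1 : ℝ)) := fun _ => rfl
  have hn : H.frame x 0 = H.normal x := rfl
  have hm : ∀ i : Fin 3, minkowski i.succ = 1 := by intro i; fin_cases i <;> simp [minkowski]
  refine Fin.cases ?_ (fun i => ?_) a <;> refine Fin.cases ?_ (fun j => ?_) b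
  · rw [hn, H.normal_unit x hx]; simp [minkowski]
  · rw [hn, ht, H.normal_orthogonal x hx]; simp [(Fin.succ_ne_zero j).symm]
  · rw [hn, ht, g.symm, H.normal_orthogonal x hx]; simp
  · rw [ht, ht, H.induced x hx]
    simp [Matrix.diagonal_apply, hm, Fin.succ_inj, PiLp.single_apply,
      EuclideanSpace.inner_single_left]

/-- The bridge from the manifold to coordinates: all results on `IsFlatInChart` become available
around each point of the hypersurface. -/
lemma isFlatInChart (p : M) :
    IsFlatInChart (g.inChart p) (extChartAt (𝓡 4) p).target (H.chartEmb p) (H.chartNormal p)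
      (H.chartDom p) where
  isOpen_W := isOpen_extChartAt_target p
  isOpen_U := H.isOpen_chartDom p
  smooth_metric := g.smoothM_inChart p
  symm_metric y _ := g.inChart_symm p y
  det_metric _ hy := g.isUnit_det_inChart hy
  smooth_map := H.contDiffOn_chartEmb p
  mapsTo _ hz := (extChartAt (𝓡 4) p).map_source hz.2
  smooth_normal := H.contDiffOn_chartNormal p
  orthonormal z hz := by
    ext a b
    rw [← H.val_frame hz.1, g.val_eq_inChart hz.2 _ _ rfl rfl, Matrix.mul_assoc, Matrix.mul_apply]
    refine Finset.sum_congr rfl fun μ _ => ?_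
    rw [Matrix.mul_apply, Finset.mul_sum]
    refine Finset.sum_congr rfl fun ν _ => ?_
    rw [Matrix.transpose_apply, H.mfderiv_extChartAt_frame hz, H.mfderiv_extChartAt_frame hz]
    simp only [chartEmb]
    ring

end FlatHypersurface

end Spacetime

/-! ### Independence of the extrinsic curvature from the chart. -/

lemma covDerivAlong_congr {G : E4 → Matrix (Fin 4) (Fin 4) ℝ} {F F' : E3 → E4}
    {V V' : E3 → Fin 4 → ℝ} {U : Set E3} {x : E3} (hU : IsOpen U) (hF : ∀ z ∈ U, F z = F' z)
    (hV : ∀ z ∈ U, V z = V' z) (hx : x ∈ U) (i : Fin 3) :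
    covDerivAlong G F V i x = covDerivAlong G F' V' i x := by
  have h1 : ∀ α, pd i (fun w => F w α) x = pd i (fun w => F' w α) x := fun α =>
    pd_congr_on hU (fun z hz => by rw [hF z hz]) hx i
  have h2 : ∀ α, pd i (fun w => V w α) x = pd i (fun w => V' w α) x := fun α =>
    pd_congr_on hU (fun z hz => by rw [hV z hz]) hx i
  ext μ
  simp only [covDerivAlong, pullbackConnection, h1, h2, hF x hx, hV x hx]

lemma chartExtrinsic_eq_sum (G : E4 → Matrix (Fin 4) (Fin 4) ℝ) (F : E3 → E4)
    (N : E3 → Fin 4 → ℝ) (x : E3) (hG : (G (F x))ᵀ = G (F x)) (i j : Fin 3) :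
    chartExtrinsic G F N i j x
      = -∑ μ, ∑ ν, G (F x) μ ν * covDerivAlong G F N i x μ * pd j (fun w => F w ν) x := by
  have hc : ∀ μ, covFrame G F N i x μ 0 = covDerivAlong G F N i x μ := fun μ => by
    simp only [covFrame, covDerivAlong, Matrix.add_apply, Matrix.mul_apply, Matrix.mulVec,
      dotProduct]
    rfl
  rw [chartExtrinsic, frameConnection, Matrix.mul_apply]
  congr 1
  refine Finset.sum_congr rfl fun μ _ => ?_
  rw [hc, Matrix.mul_apply, Finset.sum_mul]
  refine Finset.sum_congr rfl fun ν _ => ?_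
  have : G (F x) ν μ = G (F x) μ ν := congrFun (congrFun hG μ) ν
  rw [this]
  change pd j (fun w => F w ν) x * _ * _ = _
  ring

section Spacetime

variable {M : Type*} [TopologicalSpace M] [ChartedSpace E4 M] [IsManifold (𝓡 4) ∞ M]
  {g : LorentzMetric M} {p q : M}

lemma mfderiv_extChartAt_mfderiv_symm {y : E4} (hy : y ∈ transitionDom 4 p q) (v : E4) :
    mfderiv (𝓡 4) 𝓘(ℝ, E4) (extChartAt (𝓡 4) p) ((extChartAt (𝓡 4) q).symm y)
      (mfderiv 𝓘(ℝ, E4) (𝓡 4) (extChartAt (𝓡 4) q).symm y v)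
      = (WithLp.toLp 2 (transitionJacobian p q y *ᵥ WithLp.ofLp v) : E4) := by
  have h1 := mfderiv_comp (I := 𝓘(ℝ, E4)) (I' := 𝓡 4) (I'' := 𝓘(ℝ, E4)) y
    (mdifferentiableAt_extChartAt_of_mem hy.2) (mdifferentiableAt_extChartAt_symm hy.1)
  have h2 : mfderiv 𝓘(ℝ, E4) 𝓘(ℝ, E4) (extChartAt (𝓡 4) p ∘ (extChartAt (𝓡 4) q).symm) y
      = fderiv ℝ (transition p q) y := mfderiv_eq_fderiv
  have hd : DifferentiableAt ℝ (transition p q) y :=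
    ContDiffOn.diffAt (isOpen_transitionDom p q) (contDiffOn_transition p q) hy
  have h3 : fderiv ℝ (transition p q) y v
      = (WithLp.toLp 2 (transitionJacobian p q y *ᵥ WithLp.ofLp v) : E4) := by
    ext μ
    rw [fderiv_apply_coord hd, fderiv_eq_sum_pd]
    rfl
  rw [← h3, ← h2]
  exact (DFunLike.congr_fun h1 v).symm

lemma mfderiv_extChartAt_eq_jacobian {r : M} (hrp : r ∈ (extChartAt (𝓡 4) p).source)
    (hrq : r ∈ (extChartAt (𝓡 4) q).source) (v : TangentSpace (𝓡 4) r) :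
    WithLp.ofLp (p := 2) (V := Fin 4 → ℝ) (mfderiv (𝓡 4) 𝓘(ℝ, E4) (extChartAt (𝓡 4) p) r v)
      = transitionJacobian p q (extChartAt (𝓡 4) q r) *ᵥ WithLp.ofLp (p := 2) (V := Fin 4 → ℝ)
          (mfderiv (𝓡 4) 𝓘(ℝ, E4) (extChartAt (𝓡 4) q) r v) := by
  obtain ⟨y, hy, rfl⟩ : ∃ y ∈ (extChartAt (𝓡 4) q).target, (extChartAt (𝓡 4) q).symm y = r :=
    ⟨_, (extChartAt (𝓡 4) q).map_source hrq, (extChartAt (𝓡 4) q).left_inv hrq⟩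
  rw [(extChartAt (𝓡 4) q).right_inv hy]
  conv_lhs => rw [← mfderiv_symm_comp_mfderiv_extChartAt hy v]
  exact congrArg (WithLp.ofLp (p := 2) (V := Fin 4 → ℝ))
    (mfderiv_extChartAt_mfderiv_symm (p := p) (q := q) ⟨hy, hrp⟩ _)

lemma LorentzMetric.inChart_transition (g : LorentzMetric M) {y : E4}
    (hy : y ∈ transitionDom 4 p q) :
    g.inChart q y = (transitionJacobian p q y)ᵀ * g.inChart p (transition p q y)
      * transitionJacobian p q y := by
  ext α β
  have h := g.val_eq_inChart hy.2 _ _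
    (mfderiv_extChartAt_mfderiv_symm hy (EuclideanSpace.single α (1 : ℝ)))
    (mfderiv_extChartAt_mfderiv_symm hy (EuclideanSpace.single β (1 : ℝ)))
  refine h.trans ?_
  rw [Matrix.mul_assoc, Matrix.mul_apply]
  refine Finset.sum_congr rfl fun μ _ => ?_
  rw [Matrix.mul_apply, Finset.mul_sum]
  refine Finset.sum_congr rfl fun ν _ => ?_
  simp only [Matrix.transpose_apply, Matrix.mulVec, dotProduct, PiLp.ofLp_single,
    Pi.single_apply, mul_ite, mul_one, mul_zero, Finset.sum_ite_eq', Finset.mem_univ, if_true,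
    transition]
  ring

namespace FlatHypersurface

variable (H : FlatHypersurface g) {x : E3}

/-- The tangent space at `p` is the model space through the preferred chart at `p`, so the
derivative of that chart at `p` itself is the identity. -/
lemma ofLp_mfderiv_extChartAt_self (p : M) (v : TangentSpace (𝓡 4) p) :
    WithLp.ofLp (p := 2) (V := Fin 4 → ℝ) (mfderiv (𝓡 4) 𝓘(ℝ, E4) (extChartAt (𝓡 4) p) p v)
      = comp v := by
  rw [mfderiv_extChartAt_self]
  rfl

lemma comp_frame (hx : x ∈ H.dom) (a μ : Fin 4) :
    comp (H.frame x a) μ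
      = frameM (H.chartEmb (H.emb x)) (H.chartNormal (H.emb x)) x μ a := by
  rw [← H.mfderiv_extChartAt_frame (H.mem_chartDom_self hx), ofLp_mfderiv_extChartAt_self]

lemma comp_covDerivNormal (hx : x ∈ H.dom) (i : Fin 3) :
    comp (H.covDerivNormal x i) = covDerivAlong (g.inChart (H.emb x)) (H.chartEmb (H.emb x))
      (H.chartNormal (H.emb x)) i x := by
  ext μ
  have ht : ∀ α, comp (H.tangent x i) α = pd i (fun w => H.chartEmb (H.emb x) w α) x := fun α =>
    H.comp_frame hx i.succ α
  have hn : ∀ α, comp (H.normal x) α = H.chartNormal (H.emb x) x α := fun α =>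
    H.comp_frame hx 0 α
  change pd i (fun z => H.normalInChart x z μ) x
      + ∑ α, ∑ β, christoffel (g.inChart (H.emb x)) (extChartAt (𝓡 4) (H.emb x) (H.emb x)) μ α β
          * comp (H.tangent x i) α * comp (H.normal x) β = _
  simp only [ht, hn, covDerivAlong, Matrix.mulVec, dotProduct, pullbackConnection,
    Matrix.sum_apply, Matrix.smul_apply, smul_eq_mul, gammaM, Matrix.of_apply, Finset.sum_mul]
  congr 1
  rw [Finset.sum_comm]
  refine Finset.sum_congr rfl fun β _ => Finset.sum_congr rfl fun α _ => ?_
  simp only [chartEmb]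
  ring

/-- The extrinsic curvature may be computed in any chart. -/
lemma extrinsic_eq_chartExtrinsic (hx : x ∈ H.chartDom p) (i j : Fin 3) :
    H.extrinsic x i j = chartExtrinsic (g.inChart p) (H.chartEmb p) (H.chartNormal p) i j x := by
  set q := H.emb x with hq
  have hxq : x ∈ H.chartDom q := H.mem_chartDom_self hx.1
  set U := H.chartDom p ∩ H.chartDom q with hU
  have hUo : IsOpen U := (H.isOpen_chartDom p).inter (H.isOpen_chartDom q)
  have hmem : ∀ z ∈ U, H.chartEmb q z ∈ transitionDom 4 p q := by
    intro z hz
    refine ⟨(extChartAt (𝓡 4) q).map_source hz.2.2, ?_⟩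
    rw [Set.mem_preimage, chartEmb, (extChartAt (𝓡 4) q).left_inv hz.2.2]
    exact hz.1.2
  have hτ : ∀ z ∈ U, transition p q (H.chartEmb q z) = H.chartEmb p z := by
    intro z hz
    rw [transition, chartEmb, (extChartAt (𝓡 4) q).left_inv hz.2.2, chartEmb]
  have hN : ∀ z ∈ U, transitionJacobian p q (H.chartEmb q z) *ᵥ H.chartNormal q z
      = H.chartNormal p z := fun z hz =>
    (mfderiv_extChartAt_eq_jacobian hz.1.2 hz.2.2 (H.normal z)).symm
  -- Naturality is applied to the passage from the chart `q` centred at the point, where `extrinsic`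
  -- is defined, to the given chart `p`.
  have hnat := covDerivAlong_transform (isOpen_transitionDom p q) (isOpen_extChartAt_target p)
    (contDiffOn_transition p q) (fun z hz => (extChartAt (𝓡 4) p).map_source hz.2)
    (g.smoothM_inChart p) (fun z _ => g.inChart_symm p z) (fun z hz => g.isUnit_det_inChart hz)
    (fun z hz => g.isUnit_det_inChart hz.1) (J := transitionJacobian p q) (fun _ _ _ => rfl)
    (fun z hz => g.inChart_transition hz)
    (ContDiffOn.diffAt (H.isOpen_chartDom q) (H.contDiffOn_chartEmb q) hxq) (hmem x ⟨hx, hxq⟩)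
    (fun μ => ContDiffOn.diffAt (H.isOpen_chartDom q) (H.contDiffOn_chartNormal q μ) hxq) i
  rw [covDerivAlong_congr hUo hτ hN ⟨hx, hxq⟩, ← H.comp_covDerivNormal hx.1] at hnat
  have hcov : mfderiv (𝓡 4) 𝓘(ℝ, E4) (extChartAt (𝓡 4) p) q (H.covDerivNormal x i)
      = (WithLp.toLp 2 (covDerivAlong (g.inChart p) (H.chartEmb p) (H.chartNormal p) i x) : E4) := by
    rw [← hnat, ← ofLp_mfderiv_extChartAt_self]
    exact congrArg (WithLp.toLp 2)
      (mfderiv_extChartAt_eq_jacobian hx.2 hxq.2 (H.covDerivNormal x i))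
  rw [chartExtrinsic_eq_sum _ _ _ _ (g.inChart_symm p _)]
  change -g.val q (H.covDerivNormal x i) (H.tangent x j) = _
  rw [g.val_eq_inChart hx.2 _ _ hcov rfl]
  simp only [H.mfderiv_extChartAt_tangent hx]
  rfl

/-- At a neighbouring point `z` the definition refers to the chart centred at `H.emb z`, which moves
with `z`; regularity shows only after passing to one fixed chart. -/
lemma contDiffOn_extrinsic (i j : Fin 3) : ContDiffOn ℝ ∞ (fun z => H.extrinsic z i j) H.dom := by
  intro x hx
  have hU := H.isOpen_chartDom (H.emb x)
  have hx' := H.mem_chartDom_self hx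
  refine ContDiffAt.contDiffWithinAt ?_
  refine (((H.isFlatInChart (H.emb x)).smooth_chartExtrinsic i j).contDiffAt
    (hU.mem_nhds hx')).congr_of_eventuallyEq ?_
  exact Filter.eventuallyEq_of_mem (hU.mem_nhds hx') fun z hz => H.extrinsic_eq_chartExtrinsic hz i j

lemma pd_extrinsic (hx : x ∈ H.dom) (l i j : Fin 3) :
    pd l (fun z => H.extrinsic z i j) x = pd l (chartExtrinsic (g.inChart (H.emb x))
      (H.chartEmb (H.emb x)) (H.chartNormal (H.emb x)) i j) x :=
  pd_congr_on (H.isOpen_chartDom (H.emb x)) (fun _ hz => H.extrinsic_eq_chartExtrinsic hz i j)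
    (H.mem_chartDom_self hx) l

lemma extrinsic_symm (hx : x ∈ H.dom) (i j : Fin 3) : H.extrinsic x i j = H.extrinsic x j i := by
  have hx' := H.mem_chartDom_self hx
  rw [H.extrinsic_eq_chartExtrinsic hx', H.extrinsic_eq_chartExtrinsic hx',
    (H.isFlatInChart _).chartExtrinsic_symm hx']

lemma extrinsic_momentum_constraint {Λ : ℝ} (hvac : IsVacuum g Λ) (hx : x ∈ H.dom) (j : Fin 3) :
    ∑ k, pd k (fun z => H.extrinsic z j k) x = ∑ k, pd j (fun z => H.extrinsic z k k) x := by
  simp only [H.pd_extrinsic hx]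
  -- Here `c = R/2 - Λ` at the given point. It is never differentiated, so its constancy need not be
  -- known.
  exact (H.isFlatInChart _).momentum_constraint (H.mem_chartDom_self hx)
    (fun s n => ricci_eq_of_vacuum (hvac (H.emb x)) s n) j

lemma weylAt_mixed {Λ : ℝ} (hvac : IsVacuum g Λ) (hx : x ∈ H.dom) (i l s : Fin 3) :
    weylAt g (H.emb x) (H.frame x i.succ) (H.frame x 0) (H.frame x l.succ) (H.frame x s.succ)
      = pd s (fun z => H.extrinsic z l i) x - pd l (fun z => H.extrinsic z s i) x := by
  simp only [H.pd_extrinsic hx]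
  rw [← (H.isFlatInChart _).weyl_mixed (H.mem_chartDom_self hx)
    (fun s n => ricci_eq_of_vacuum (hvac (H.emb x)) s n) i l s]
  simp only [weylAt, H.comp_frame hx]
  rfl

end FlatHypersurface

end Spacetime

/-! ### Values of the antisymmetric symbol. -/

lemma leviCivita_eq_zero {n : ℕ} {f : Fin n → Fin n} {i j : Fin n} (hij : i ≠ j) (h : f i = f j) :
    leviCivita f = 0 :=
  Matrix.det_zero_of_row_eq hij (by ext k; simp [h])

lemma leviCivita_three (a b c : Fin 3) : leviCivita ![a, b, c] =
    (if a = 0 then 1 else 0) * (if b = 1 then 1 else 0) * (if c = 2 then 1 else 0)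
    - (if a = 0 then 1 else 0) * (if b = 2 then 1 else 0) * (if c = 1 then 1 else 0)
    - (if a = 1 then 1 else 0) * (if b = 0 then 1 else 0) * (if c = 2 then 1 else 0)
    + (if a = 1 then 1 else 0) * (if b = 2 then 1 else 0) * (if c = 0 then 1 else 0)
    + (if a = 2 then 1 else 0) * (if b = 0 then 1 else 0) * (if c = 1 then 1 else 0)
    - (if a = 2 then 1 else 0) * (if b = 1 then 1 else 0) * (if c = 0 then (1 : ℝ) else 0) := by
  rw [leviCivita, Matrix.det_fin_three]
  fin_cases a <;> fin_cases b <;> fin_cases c <;> simp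

/-- Column `0` of the determinant has its only nonzero entry in the third row, where the cofactor
sign is positive. -/
lemma leviCivita_succ (l s j : Fin 3) :
    leviCivita ![l.succ, s.succ, 0, j.succ] = leviCivita ![l, s, j] := by
  rw [leviCivita, Matrix.det_succ_column_zero, Fin.sum_univ_four]
  simp only [Matrix.of_apply, Matrix.cons_val_zero, Matrix.cons_val_one, Matrix.cons_val,
    Fin.succ_ne_zero, if_false, if_true, mul_zero, zero_mul, add_zero, zero_add]
  rw [leviCivita, Matrix.det_fin_three, Matrix.det_fin_three]
  fin_cases l <;> fin_cases s <;> fin_cases j <;>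
    simp [Fin.succAbove, Matrix.submatrix_apply, Fin.lt_def, Fin.ext_iff]

/-! ### The magnetic tensor as a curl, and the comparison of the two currents. -/

section Magnetic

variable {M : Type*} [TopologicalSpace M] [ChartedSpace E4 M] [IsManifold (𝓡 4) ∞ M]
  {g : LorentzMetric M} (H : FlatHypersurface g) {x : E3}

/-- The magnetic part of the Weyl tensor is a curl of the extrinsic curvature. -/
lemma FlatHypersurface.magnetic_eq {Λ : ℝ} (hvac : IsVacuum g Λ) (hx : x ∈ H.dom) (i j : Fin 3) :
    H.magnetic x i j = (1 / 2) * ∑ l, ∑ s, (pd s (fun z => H.extrinsic z l i) x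
      - pd l (fun z => H.extrinsic z s i) x) * leviCivita ![l, s, j] := by
  have hm : ∀ i : Fin 3, minkowski i.succ = 1 := by intro i; fin_cases i <;> simp [minkowski]
  -- The third slot of the symbol holds the normal index, so only spatial `l` and `s` survive, for
  -- which the frame signs are `+1`.
  have h0 : ∀ s, leviCivita ![0, s, 0, j.succ] = 0 := fun s =>
    leviCivita_eq_zero (i := 0) (j := 2) (by decide) rfl
  have h1 : ∀ l, leviCivita ![l, 0, 0, j.succ] = 0 := fun s =>
    leviCivita_eq_zero (i := 1) (j := 2) (by decide) rfl
  change (1 / 2) * ∑ l, ∑ s, weylAt g (H.emb x) (H.frame x i.succ) (H.frame x 0) (H.frame x l)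
      (H.frame x s) * minkowski l * minkowski s * leviCivita ![l, s, 0, j.succ] = _
  rw [Fin.sum_univ_succ]
  simp only [h0, mul_zero, Finset.sum_const_zero, zero_add]
  congr 1
  refine Finset.sum_congr rfl fun l _ => ?_
  rw [Fin.sum_univ_succ, h1, mul_zero, zero_add]
  refine Finset.sum_congr rfl fun s _ => ?_
  rw [H.weylAt_mixed hvac hx, hm, hm, mul_one, mul_one, leviCivita_succ]

/-- The contraction of the extrinsic curvature with a vector field. -/
def FlatHypersurface.extrinsicContract (X : E3 → Fin 3 → ℝ) (s : Fin 3) (z : E3) : ℝ :=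
  ∑ j, H.extrinsic z s j * X z j

/-- The curl of a vector field on `ℝ³`. -/
def curl (V : Fin 3 → E3 → ℝ) (i : Fin 3) (x : E3) : ℝ :=
  ∑ l, ∑ s, leviCivita ![i, l, s] * pd l (V s) x

lemma norm_sq_eq_three (x : E3) : ‖x‖ ^ 2 = x 0 * x 0 + x 1 * x 1 + x 2 * x 2 := by
  rw [EuclideanSpace.norm_sq_eq, Fin.sum_univ_three]
  simp [sq]

lemma contDiff_coord (j : Fin 3) : ContDiff ℝ ∞ (fun z : E3 => z j) :=
  contDiff_euclidean.1 contDiff_id j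

lemma contDiff_properConformalGenerator (k j : Fin 3) :
    ContDiff ℝ ∞ (fun z => properConformalGenerator k z j) := by
  simp only [properConformalGenerator, scalingGenerator, norm_sq_eq_three]
  have := contDiff_coord
  exact ((this k).mul (this j)).sub ((contDiff_const.mul
    ((((this 0).mul (this 0)).add ((this 1).mul (this 1))).add ((this 2).mul (this 2)))).mul
      contDiff_const)

/-- The middle term is pure trace and the outer two are antisymmetric in `j`, `l`: this is the
conformal Killing equation together with the rotation that enters the angular momentum. -/
lemma pd_properConformalGenerator (k j l : Fin 3) (x : E3) :
    pd l (fun z => properConformalGenerator k z j) x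
      = (if k = l then 1 else 0) * x j + x k * (if j = l then 1 else 0)
        - x l * (if j = k then 1 else 0) := by
  have hd : ∀ j, DifferentiableAt ℝ (fun z : E3 => z j) x := fun j =>
    (contDiff_coord j).differentiable (by simp) x
  have e : (fun z => properConformalGenerator k z j) = fun z => z k * z j
      - (1 / 2) * (z 0 * z 0 + z 1 * z 1 + z 2 * z 2) * (if j = k then 1 else 0) := by
    ext z
    rw [← norm_sq_eq_three]
    rfl
  have d2 : ∀ a b, DifferentiableAt ℝ (fun z : E3 => z a * z b) x := fun a b => (hd a).mul (hd b)
  have d3 : DifferentiableAt ℝ (fun z : E3 => z 0 * z 0 + z 1 * z 1) x := (d2 0 0).add (d2 1 1)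
  have d4 : DifferentiableAt ℝ (fun z : E3 => z 0 * z 0 + z 1 * z 1 + z 2 * z 2) x :=
    d3.add (d2 2 2)
  have d5 : DifferentiableAt ℝ (fun z : E3 => (1 / 2) * (z 0 * z 0 + z 1 * z 1 + z 2 * z 2)) x :=
    d4.const_mul _
  rw [e, pd_sub l (d2 k j) (d5.mul_const _), pd_mul l d5 (differentiableAt_const _),
    pd_mul l (differentiableAt_const _) d4, pd_add l d3 (d2 2 2), pd_add l (d2 0 0) (d2 1 1)]
  simp only [pd_mul l (hd _) (hd _), pd_coord, pd_const]
  fin_cases l <;> fin_cases j <;> fin_cases k <;> simp <;> ring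

lemma FlatHypersurface.contDiffOn_extrinsicContract {X : E3 → Fin 3 → ℝ}
    (hX : ∀ j, ContDiff ℝ ∞ (fun z => X z j)) (s : Fin 3) :
    ContDiffOn ℝ ∞ (H.extrinsicContract X s) H.dom :=
  ContDiffOn.sum fun j _ => (H.contDiffOn_extrinsic s j).mul (hX j).contDiffOn

/-- The magnetic part of the Weyl tensor is symmetric. -/
lemma FlatHypersurface.magnetic_symm {Λ : ℝ} (hvac : IsVacuum g Λ) (hx : x ∈ H.dom) (i j : Fin 3) :
    H.magnetic x i j = H.magnetic x j i := by
  rw [H.magnetic_eq hvac hx, H.magnetic_eq hvac hx]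
  have hDs : ∀ l a b, pd l (fun z => H.extrinsic z a b) x = pd l (fun z => H.extrinsic z b a) x :=
    fun l a b => pd_congr_on H.isOpen_dom (fun z hz => H.extrinsic_symm hz a b) hx l
  -- The antisymmetric part of the curl of a symmetric tensor is its divergence minus the gradient
  -- of its trace.
  have hmom := H.extrinsic_momentum_constraint hvac hx
  have m0 := hmom 0
  have m1 := hmom 1
  have m2 := hmom 2
  simp only [Fin.sum_univ_three, hDs _ 1 0, hDs _ 2 0, hDs _ 2 1] at m0 m1 m2
  fin_cases i <;> fin_cases j <;>
    simp [Fin.sum_univ_three, leviCivita_three, hDs _ 1 0, hDs _ 2 0, hDs _ 2 1] <;> linarith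

/-- Pointwise, the conformal current of the magnetic part and the rotational current of the
momentum differ by a curl. -/
lemma FlatHypersurface.magnetic_contract_eq {Λ : ℝ} (hvac : IsVacuum g Λ) (hx : x ∈ H.dom)
    (k i : Fin 3) :
    ∑ j, H.magnetic x i j * properConformalGenerator k x j
      = ∑ j, H.momentum x i j * rotationGenerator k x j
        - curl (H.extrinsicContract (properConformalGenerator k)) i x := by
  have hV : ∀ l s, pd l (H.extrinsicContract (properConformalGenerator k) s) x
      = ∑ j, (pd l (fun z => H.extrinsic z s j) x * properConformalGenerator k x j
        + H.extrinsic x s j * ((if k = l then 1 else 0) * x j + x k * (if j = l then 1 else 0)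
          - x l * (if j = k then 1 else 0))) := by
    intro l s
    have d1 : ∀ j, DifferentiableAt ℝ (fun z => H.extrinsic z s j) x := fun j =>
      ContDiffOn.diffAt H.isOpen_dom (H.contDiffOn_extrinsic s j) hx
    have d2 : ∀ j, DifferentiableAt ℝ (fun z => properConformalGenerator k z j) x := fun j =>
      (contDiff_properConformalGenerator k j).differentiable (by simp) x
    unfold extrinsicContract
    rw [pd_sum (f := fun j z => H.extrinsic z s j * properConformalGenerator k z j) _ _
      fun j _ => (d1 j).mul (d2 j)]
    refine Finset.sum_congr rfl fun j _ => ?_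
    rw [pd_mul l (d1 j) (d2 j), pd_properConformalGenerator]
  -- Symmetry of `B` moves the curl onto the free index `i`; only then does contraction with `X`
  -- produce the curl of a vector field.
  have hB : ∀ j, H.magnetic x i j = (1 / 2) * ∑ l, ∑ s, (pd s (fun z => H.extrinsic z l j) x
      - pd l (fun z => H.extrinsic z s j) x) * leviCivita ![l, s, i] := fun j => by
    rw [H.magnetic_symm hvac hx, H.magnetic_eq hvac hx]
  have hKs := H.extrinsic_symm hx
  have hP : ∀ a b, H.momentum x a b = -H.extrinsic x a b
      + (∑ c, H.extrinsic x c c) * (if a = b then 1 else 0) := by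
    intro a b
    simp only [momentum, Matrix.add_apply, Matrix.neg_apply, Matrix.smul_apply, Matrix.one_apply,
      smul_eq_mul, Matrix.trace, Matrix.diag_apply]
  simp only [curl, hV, hB, hP, rotationGenerator]
  -- The terms containing `X` undifferentiated agree on both sides, so its values no longer matter.
  -- What is left is an algebraic identity in the symmetric `K` and in `x`.
  generalize properConformalGenerator k x = X
  fin_cases k <;> fin_cases i <;>
    simp [Fin.sum_univ_three, leviCivita_three, hKs 1 0, hKs 2 0, hKs 2 1] <;> ring

end Magnetic

/-! ### Integration over closed surfaces -/

/-- The triple product. -/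
def tripleProduct (n u v : Fin 3 → ℝ) : ℝ :=
  n 0 * (u 1 * v 2 - u 2 * v 1) + n 1 * (u 2 * v 0 - u 0 * v 2) + n 2 * (u 0 * v 1 - u 1 * v 0)

/-- By the double cross product formula `n × (u × v) = u (n·v) - v (n·u) = 0`, hence `u × v` is
parallel to the unit vector `n`. -/
lemma cross_eq_smul {n u v : Fin 3 → ℝ} (hn : n 0 * n 0 + n 1 * n 1 + n 2 * n 2 = 1)
    (hu : n 0 * u 0 + n 1 * u 1 + n 2 * u 2 = 0) (hv : n 0 * v 0 + n 1 * v 1 + n 2 * v 2 = 0) :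
    u 1 * v 2 - u 2 * v 1 = tripleProduct n u v * n 0 ∧
    u 2 * v 0 - u 0 * v 2 = tripleProduct n u v * n 1 ∧
    u 0 * v 1 - u 1 * v 0 = tripleProduct n u v * n 2 := by
  have e0 : u 0 * (n 0 * v 0 + n 1 * v 1 + n 2 * v 2) - v 0 * (n 0 * u 0 + n 1 * u 1 + n 2 * u 2)
    = 0 := by rw [hu, hv]; ring
  have e1 : u 1 * (n 0 * v 0 + n 1 * v 1 + n 2 * v 2) - v 1 * (n 0 * u 0 + n 1 * u 1 + n 2 * u 2)
    = 0 := by rw [hu, hv]; ring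
  have e2 : u 2 * (n 0 * v 0 + n 1 * v 1 + n 2 * v 2) - v 2 * (n 0 * u 0 + n 1 * u 1 + n 2 * u 2)
    = 0 := by rw [hu, hv]; ring
  unfold tripleProduct
  refine ⟨?_, ?_, ?_⟩
  · linear_combination -(u 1 * v 2 - u 2 * v 1) * hn - n 1 * e2 + n 2 * e1
  · linear_combination -(u 2 * v 0 - u 0 * v 2) * hn - n 2 * e0 + n 0 * e2
  · linear_combination -(u 0 * v 1 - u 1 * v 0) * hn - n 0 * e1 + n 1 * e0

lemma det_euclideanPlane (L : E2 →L[ℝ] E2) :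
    L.det = L (EuclideanSpace.single 0 1) 0 * L (EuclideanSpace.single 1 1) 1
      - L (EuclideanSpace.single 1 1) 0 * L (EuclideanSpace.single 0 1) 1 := by
  have h := LinearMap.det_toMatrix (EuclideanSpace.basisFun (Fin 2) ℝ).toBasis (L : E2 →ₗ[ℝ] E2)
  change LinearMap.det (L : E2 →ₗ[ℝ] E2) = _
  rw [← h, Matrix.det_fin_two]
  simp [LinearMap.toMatrix_apply]

section

variable {n : ℕ}

/-- Integration by parts against the constant function `1`. -/
lemma integral_pd_eq_zero {f : EuclideanSpace ℝ (Fin n) → ℝ} (hf : ContDiff ℝ 1 f)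
    (hc : HasCompactSupport f) (b : Fin n) : ∫ y, pd b f y = 0 := by
  have h1 : Continuous (fun y => fderiv ℝ f y (EuclideanSpace.single b 1)) :=
    (hf.continuous_fderiv one_ne_zero).clm_apply continuous_const
  have h := integral_mul_fderiv_eq_neg_fderiv_mul_of_integrable (𝕜 := ℝ) (μ := volume)
    (f := fun _ : EuclideanSpace ℝ (Fin n) => (1 : ℝ)) (g := f) (v := EuclideanSpace.single b 1)
    (by simp) (by simpa using h1.integrable_of_hasCompactSupport (hc.fderiv_apply (𝕜 := ℝ) _))
    (by simpa using hf.continuous.integrable_of_hasCompactSupport hc) (by simp)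
    (fun x _ => hf.differentiable one_ne_zero x)
  simpa [pd] using h

lemma integrable_pd {f : EuclideanSpace ℝ (Fin n) → ℝ} (hf : ContDiff ℝ 1 f)
    (hc : HasCompactSupport f) (b : Fin n) : Integrable (pd b f) := by
  have h1 : Continuous (fun y => fderiv ℝ f y (EuclideanSpace.single b 1)) :=
    (hf.continuous_fderiv one_ne_zero).clm_apply continuous_const
  exact h1.integrable_of_hasCompactSupport (hc.fderiv_apply (𝕜 := ℝ) _)

end

/-! ### Changes of charts on a surface. -/

section Surface

variable {A : Type*} [TopologicalSpace A] [ChartedSpace E2 A] {i j : A}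
  {y : E2}

lemma continuousOn_symm_extChartAt [IsManifold (𝓡 2) ∞ A] (i : A) :
    ContinuousOn (extChartAt (𝓡 2) i).symm (extChartAt (𝓡 2) i).target :=
  (contMDiffOn_extChartAt_symm (I := 𝓡 2) (n := ∞) i).continuousOn

lemma contDiffOn_comp_symm [IsManifold (𝓡 2) ∞ A] {ψ : A → ℝ}
    (hψ : ContMDiff (𝓡 2) 𝓘(ℝ) ∞ ψ) (i : A) :
    ContDiffOn ℝ ∞ (fun y => ψ ((extChartAt (𝓡 2) i).symm y)) (extChartAt (𝓡 2) i).target :=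
  (hψ.comp_contMDiffOn (contMDiffOn_extChartAt_symm (I := 𝓡 2) (n := ∞) i)).contDiffOn

lemma transition_mem (hy : y ∈ transitionDom 2 j i) : transition j i y ∈ transitionDom 2 i j := by
  refine ⟨(extChartAt (𝓡 2) j).map_source hy.2, ?_⟩
  rw [Set.mem_preimage, transition, (extChartAt (𝓡 2) j).left_inv hy.2]
  exact (extChartAt (𝓡 2) i).map_target hy.1

lemma symm_transition (hy : y ∈ transitionDom 2 j i) :
    (extChartAt (𝓡 2) j).symm (transition j i y) = (extChartAt (𝓡 2) i).symm y :=
  (extChartAt (𝓡 2) j).left_inv hy.2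

lemma transition_transition (hy : y ∈ transitionDom 2 j i) :
    transition i j (transition j i y) = y := by
  rw [transition, symm_transition hy, (extChartAt (𝓡 2) i).right_inv hy.1]

lemma pd_transition [IsManifold (𝓡 2) ∞ A] {ψ : A → ℝ}
    (hψ : ContMDiff (𝓡 2) 𝓘(ℝ) ∞ ψ) (hy : y ∈ transitionDom 2 j i)
    (b : Fin 2) :
    pd b (fun w => ψ ((extChartAt (𝓡 2) i).symm w)) y
      = ∑ a, pd a (fun w => ψ ((extChartAt (𝓡 2) j).symm w)) (transition j i y)
        * transitionJacobian j i y a b := by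
  have ho : IsOpen (transitionDom 2 j i) := isOpen_transitionDom j i
  rw [pd_congr_on ho (f := fun w => ψ ((extChartAt (𝓡 2) i).symm w))
    (g := fun w => (fun u => ψ ((extChartAt (𝓡 2) j).symm u)) (transition j i w))
    (fun z hz => by simp only [symm_transition hz]) hy]
  exact pd_comp (f := fun u => ψ ((extChartAt (𝓡 2) j).symm u)) b
    (ContDiffOn.diffAt (isOpen_extChartAt_target j) (contDiffOn_comp_symm hψ j)
      (transition_mem hy).1) (ContDiffOn.diffAt ho (contDiffOn_transition j i) hy)

/-- Change of variables between two charts of a surface. -/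
lemma setIntegral_transition [IsManifold (𝓡 2) ∞ A] {k : E2 → ℝ} {l : E2 → ℝ}
    (hk : ∀ y ∈ (extChartAt (𝓡 2) i).target, y ∉ transitionDom 2 j i → k y = 0)
    (hl : ∀ y ∈ (extChartAt (𝓡 2) j).target, y ∉ transitionDom 2 i j → l y = 0)
    (hkl : ∀ y ∈ transitionDom 2 j i, k y = |(transitionJacobian j i y).det| * l (transition j i y)) :
    ∫ y in (extChartAt (𝓡 2) i).target, k y = ∫ y in (extChartAt (𝓡 2) j).target, l y := by
  have ho : IsOpen (transitionDom 2 j i) := isOpen_transitionDom j i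
  have ho' : IsOpen (transitionDom 2 i j) := isOpen_transitionDom i j
  have himg : transition j i '' transitionDom 2 j i = transitionDom 2 i j := by
    ext z
    constructor
    · rintro ⟨y, hy, rfl⟩
      exact transition_mem hy
    · intro hz
      exact ⟨transition i j z, transition_mem hz, transition_transition hz⟩
  have hinj : Set.InjOn (transition j i) (transitionDom 2 j i) := fun y hy z hz h => by
    rw [← transition_transition hy, h, transition_transition hz]
  have hd : ∀ y ∈ transitionDom 2 j i, DifferentiableAt ℝ (transition j i) y := fun y hy =>
    ContDiffOn.diffAt ho (contDiffOn_transition j i) hy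
  have hs : ∀ a b : A, transitionDom 2 a b ⊆ (extChartAt (𝓡 2) b).target := fun _ _ =>
    Set.inter_subset_left
  -- Both integrands vanish off the overlap of the charts, and there the transition map is an
  -- injective change of variables.
  rw [setIntegral_eq_of_subset_of_forall_sdiff_eq_zero (isOpen_extChartAt_target i).measurableSet
      (hs j i) (fun y hy => hk y hy.1 hy.2),
    setIntegral_eq_of_subset_of_forall_sdiff_eq_zero (isOpen_extChartAt_target j).measurableSet
      (hs i j) (fun y hy => hl y hy.1 hy.2),
    ← himg, integral_image_eq_integral_abs_det_fderiv_smul volume ho.measurableSet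
      (fun y hy => (hd y hy).hasFDerivAt.hasFDerivWithinAt) hinj l]
  refine setIntegral_congr_fun ho.measurableSet fun y hy => ?_
  have : (fderiv ℝ (transition j i) y).det = (transitionJacobian j i y).det := by
    rw [det_euclideanPlane, Matrix.det_fin_two]
    simp only [fderiv_apply_coord (hd y hy)]
    rfl
  simp only [hkl y hy, this, smul_eq_mul]

lemma isCompact_image_tsupport [CompactSpace A] {χ : A → ℝ}
    (hsupp : tsupport χ ⊆ (extChartAt (𝓡 2) i).source) :
    IsCompact (extChartAt (𝓡 2) i '' tsupport χ) :=
  (isClosed_tsupport χ).isCompact.image_of_continuousOn ((continuousOn_extChartAt i).mono hsupp)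

lemma symm_notMem_tsupport {χ : A → ℝ} (hy : y ∈ (extChartAt (𝓡 2) i).target)
    (hy' : y ∉ extChartAt (𝓡 2) i '' tsupport χ) :
    (extChartAt (𝓡 2) i).symm y ∉ tsupport χ := fun h =>
  hy' ⟨_, h, (extChartAt (𝓡 2) i).right_inv hy⟩

end Surface

/-! ### The oriented area form and Stokes' theorem inside a chart. -/

namespace ClosedSurface

variable {A : Type*} [TopologicalSpace A] [ChartedSpace E2 A] [IsManifold (𝓡 2) ∞ A] [T2Space A]
  [CompactSpace A] {S : Set E3} (F : ClosedSurface S A) {i j : A} {y : E2}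

/-- The components of the immersion in a chart. -/
def chartMap (i : A) (k : Fin 3) (y : E2) : ℝ := F.imm ((extChartAt (𝓡 2) i).symm y) k

/-- The oriented area form in a chart. -/
def areaForm (i : A) (y : E2) : ℝ :=
  tripleProduct (fun k => F.normal ((extChartAt (𝓡 2) i).symm y) k)
    (fun k => pd 0 (F.chartMap i k) y) (fun k => pd 1 (F.chartMap i k) y)

lemma contMDiff_imm_coord (k : Fin 3) : ContMDiff (𝓡 2) 𝓘(ℝ) ∞ (fun a => F.imm a k) :=
  (contDiff_coord k).contMDiff.comp F.contMDiff_imm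

lemma contDiffOn_chartMap (i : A) (k : Fin 3) :
    ContDiffOn ℝ ∞ (F.chartMap i k) (extChartAt (𝓡 2) i).target :=
  contDiffOn_comp_symm (F.contMDiff_imm_coord k) i

lemma contDiffOn_imm_symm (i : A) :
    ContDiffOn ℝ ∞ (F.imm ∘ (extChartAt (𝓡 2) i).symm) (extChartAt (𝓡 2) i).target :=
  (F.contMDiff_imm.comp_contMDiffOn (contMDiffOn_extChartAt_symm (I := 𝓡 2) (n := ∞) i)).contDiffOn

lemma fderiv_imm_symm (hy : y ∈ (extChartAt (𝓡 2) i).target) (b : Fin 2) (k : Fin 3) :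
    fderiv ℝ (F.imm ∘ (extChartAt (𝓡 2) i).symm) y (EuclideanSpace.single b 1) k
      = pd b (F.chartMap i k) y :=
  fderiv_apply_coord (ContDiffOn.diffAt (isOpen_extChartAt_target i) (F.contDiffOn_imm_symm i) hy)
    _ k

lemma fderiv_imm_symm_eq_mfderiv (hy : y ∈ (extChartAt (𝓡 2) i).target) (v : E2) :
    fderiv ℝ (F.imm ∘ (extChartAt (𝓡 2) i).symm) y v
      = mfderiv (𝓡 2) (𝓡 3) F.imm ((extChartAt (𝓡 2) i).symm y)
        (mfderiv 𝓘(ℝ, E2) (𝓡 2) (extChartAt (𝓡 2) i).symm y v) := by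
  rw [← mfderiv_eq_fderiv]
  have := mfderiv_comp (I := 𝓘(ℝ, E2)) (I' := 𝓡 2) (I'' := 𝓡 3) y
    (F.contMDiff_imm.mdifferentiable (by simp) _) (mdifferentiableAt_extChartAt_symm hy)
  exact DFunLike.congr_fun this v

lemma normal_dot_pd (hy : y ∈ (extChartAt (𝓡 2) i).target) (b : Fin 2) :
    F.normal ((extChartAt (𝓡 2) i).symm y) 0 * pd b (F.chartMap i 0) y
      + F.normal ((extChartAt (𝓡 2) i).symm y) 1 * pd b (F.chartMap i 1) y
      + F.normal ((extChartAt (𝓡 2) i).symm y) 2 * pd b (F.chartMap i 2) y = 0 := by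
  have h := F.normal_orthogonal ((extChartAt (𝓡 2) i).symm y)
    (mfderiv 𝓘(ℝ, E2) (𝓡 2) (extChartAt (𝓡 2) i).symm y (EuclideanSpace.single b 1))
  rw [← F.fderiv_imm_symm_eq_mfderiv hy, PiLp.inner_apply, Fin.sum_univ_three] at h
  simp only [F.fderiv_imm_symm hy, RCLike.inner_apply, conj_trivial] at h
  linarith

lemma normal_dot_self (a : A) :
    F.normal a 0 * F.normal a 0 + F.normal a 1 * F.normal a 1 + F.normal a 2 * F.normal a 2 = 1 := by
  rw [← norm_sq_eq_three, F.norm_normal, one_pow]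

lemma cross_pd (hy : y ∈ (extChartAt (𝓡 2) i).target) :
    pd 0 (F.chartMap i 1) y * pd 1 (F.chartMap i 2) y
        - pd 0 (F.chartMap i 2) y * pd 1 (F.chartMap i 1) y
      = F.areaForm i y * F.normal ((extChartAt (𝓡 2) i).symm y) 0 ∧
    pd 0 (F.chartMap i 2) y * pd 1 (F.chartMap i 0) y
        - pd 0 (F.chartMap i 0) y * pd 1 (F.chartMap i 2) y
      = F.areaForm i y * F.normal ((extChartAt (𝓡 2) i).symm y) 1 ∧
    pd 0 (F.chartMap i 0) y * pd 1 (F.chartMap i 1) y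
        - pd 0 (F.chartMap i 1) y * pd 1 (F.chartMap i 0) y
      = F.areaForm i y * F.normal ((extChartAt (𝓡 2) i).symm y) 2 :=
  cross_eq_smul (n := fun k => F.normal ((extChartAt (𝓡 2) i).symm y) k)
    (u := fun k => pd 0 (F.chartMap i k) y) (v := fun k => pd 1 (F.chartMap i k) y)
    (F.normal_dot_self _) (F.normal_dot_pd hy 0) (F.normal_dot_pd hy 1)

/-- Lagrange's identity: the Gram determinant is `|u × v|²`, and `u × v` is the area form times a
unit vector. -/
lemma areaDensity_eq (hy : y ∈ (extChartAt (𝓡 2) i).target) :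
    F.areaDensity i y = |F.areaForm i y| := by
  obtain ⟨h0, h1, h2⟩ := F.cross_pd hy
  have hn := F.normal_dot_self ((extChartAt (𝓡 2) i).symm y)
  rw [areaDensity, ← Real.sqrt_sq_eq_abs, Matrix.det_fin_two]
  congr 1
  simp only [Matrix.of_apply, PiLp.inner_apply, Fin.sum_univ_three, F.fderiv_imm_symm hy,
    RCLike.inner_apply, conj_trivial]
  set o := F.areaForm i y
  calc _ = (pd 0 (F.chartMap i 1) y * pd 1 (F.chartMap i 2) y
        - pd 0 (F.chartMap i 2) y * pd 1 (F.chartMap i 1) y) ^ 2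
      + (pd 0 (F.chartMap i 2) y * pd 1 (F.chartMap i 0) y
        - pd 0 (F.chartMap i 0) y * pd 1 (F.chartMap i 2) y) ^ 2
      + (pd 0 (F.chartMap i 0) y * pd 1 (F.chartMap i 1) y
        - pd 0 (F.chartMap i 1) y * pd 1 (F.chartMap i 0) y) ^ 2 := by ring
    _ = o ^ 2 := by
      rw [h0, h1, h2]
      linear_combination o ^ 2 * hn

lemma areaForm_ne_zero (hy : y ∈ (extChartAt (𝓡 2) i).target) : F.areaForm i y ≠ 0 := by
  intro h
  obtain ⟨h0, h1, h2⟩ := F.cross_pd hy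
  rw [h, zero_mul] at h0 h1 h2
  set u : Fin 3 → ℝ := fun k => pd 0 (F.chartMap i k) y with hu
  set v : Fin 3 → ℝ := fun k => pd 1 (F.chartMap i k) y with hv
  have hinj : ∀ w : E2, fderiv ℝ (F.imm ∘ (extChartAt (𝓡 2) i).symm) y w = 0 → w = 0 := by
    intro w hw
    rw [F.fderiv_imm_symm_eq_mfderiv hy] at hw
    have h3 := F.injective_mfderiv _ (hw.trans (map_zero _).symm)
    have h4 := mfderiv_extChartAt_comp_mfderiv_symm hy w
    rw [h3, map_zero] at h4
    exact h4.symm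
  have hcomb : ∀ a b : ℝ, (∀ k, a * u k + b * v k = 0) → a = 0 ∧ b = 0 := by
    intro a b hab
    have h5 := hinj (a • EuclideanSpace.single 0 1 + b • EuclideanSpace.single 1 1) (by
      ext k
      simp only [map_add, map_smul, PiLp.add_apply, PiLp.smul_apply, F.fderiv_imm_symm hy,
        smul_eq_mul, PiLp.zero_apply]
      exact hab k)
    exact ⟨by simpa using congrArg (fun z : E2 => z 0) h5,
      by simpa using congrArg (fun z : E2 => z 1) h5⟩
  change u 1 * v 2 - u 2 * v 1 = 0 at h0
  change u 2 * v 0 - u 0 * v 2 = 0 at h1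
  change u 0 * v 1 - u 1 * v 0 = 0 at h2
  -- The coefficients come from `u × (u × v) = (u·v) u - |u|² v`. Independence forces `|u|² = 0`, so
  -- `u = 0`, which contradicts independence.
  have h6 := (hcomb (u 0 * v 0 + u 1 * v 1 + u 2 * v 2) (-(u 0 * u 0 + u 1 * u 1 + u 2 * u 2))
    (by
      intro k
      fin_cases k
      · change _ * u 0 + _ * v 0 = 0
        linear_combination u 1 * h2 - u 2 * h1
      · change _ * u 1 + _ * v 1 = 0
        linear_combination u 2 * h0 - u 0 * h2
      · change _ * u 2 + _ * v 2 = 0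
        linear_combination u 0 * h1 - u 1 * h0)).2
  have h7 : ∀ k, u k = 0 := by
    intro k
    have p0 := mul_self_nonneg (u 0)
    have p1 := mul_self_nonneg (u 1)
    have p2 := mul_self_nonneg (u 2)
    fin_cases k
    · exact mul_self_eq_zero.1 (show u 0 * u 0 = 0 by linarith)
    · exact mul_self_eq_zero.1 (show u 1 * u 1 = 0 by linarith)
    · exact mul_self_eq_zero.1 (show u 2 * u 2 = 0 by linarith)
  exact one_ne_zero (hcomb 1 0 fun k => by rw [h7 k]; ring).1

lemma continuousOn_areaForm (i : A) :
    ContinuousOn (F.areaForm i) (extChartAt (𝓡 2) i).target := by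
  have hn : ∀ k, ContinuousOn (fun y => F.normal ((extChartAt (𝓡 2) i).symm y) k)
      (extChartAt (𝓡 2) i).target := fun k =>
    ((contDiff_coord k).continuous.comp F.continuous_normal).comp_continuousOn
      (continuousOn_symm_extChartAt i)
  have hp : ∀ b k, ContinuousOn (fun y => pd b (F.chartMap i k) y) (extChartAt (𝓡 2) i).target :=
    fun b k => (contDiffOn_pd (isOpen_extChartAt_target i) (F.contDiffOn_chartMap i k) b).continuousOn
  unfold areaForm tripleProduct
  exact (((hn 0).mul (((hp 0 1).mul (hp 1 2)).sub ((hp 0 2).mul (hp 1 1)))).add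
    ((hn 1).mul (((hp 0 2).mul (hp 1 0)).sub ((hp 0 0).mul (hp 1 2))))).add
    ((hn 2).mul (((hp 0 0).mul (hp 1 1)).sub ((hp 0 1).mul (hp 1 0))))

/-- The form carries the signed Jacobian, as `wedge` does; hence their ratio is a function on the
surface. The area density carries its absolute value. -/
lemma areaForm_transition (hy : y ∈ transitionDom 2 j i) :
    F.areaForm i y = (transitionJacobian j i y).det * F.areaForm j (transition j i y) := by
  have h : ∀ b k, pd b (F.chartMap i k) y = pd 0 (F.chartMap j k) (transition j i y)
      * transitionJacobian j i y 0 b + pd 1 (F.chartMap j k) (transition j i y)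
      * transitionJacobian j i y 1 b := fun b k => by
    rw [← Fin.sum_univ_two (fun a => pd a (F.chartMap j k) (transition j i y)
      * transitionJacobian j i y a b)]
    exact pd_transition (F.contMDiff_imm_coord k) hy b
  simp only [areaForm, tripleProduct, h, symm_transition hy, Matrix.det_fin_two]
  ring

variable (V : Fin 3 → E3 → ℝ) (χ : A → ℝ)

/-- The pull-back of a one-form to a chart. -/
def oneForm (i : A) (b : Fin 2) (y : E2) : ℝ :=
  ∑ s, V s (F.imm ((extChartAt (𝓡 2) i).symm y)) * pd b (F.chartMap i s) y

/-- The component of `dχ ∧ V` in a chart. -/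
def wedge (i : A) (y : E2) : ℝ :=
  pd 0 (fun w => χ ((extChartAt (𝓡 2) i).symm w)) y * F.oneForm V i 1 y
    - pd 1 (fun w => χ ((extChartAt (𝓡 2) i).symm w)) y * F.oneForm V i 0 y

/-- The flux density of the curl. -/
def curlFlux (a : A) : ℝ := ∑ k, curl V k (F.imm a) * F.normal a k

/-- The density of `d(χ V)` relative to the oriented area form. -/
def exactDensity (a : A) : ℝ :=
  χ a * F.curlFlux V a
    + F.wedge V χ a (extChartAt (𝓡 2) a a) / F.areaForm a (extChartAt (𝓡 2) a a)

variable {V χ}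

lemma wedge_transition (hχ : ContMDiff (𝓡 2) 𝓘(ℝ) ∞ χ) (hy : y ∈ transitionDom 2 j i) :
    F.wedge V χ i y = (transitionJacobian j i y).det * F.wedge V χ j (transition j i y) := by
  have h : ∀ b k, pd b (F.chartMap i k) y = ∑ a, pd a (F.chartMap j k) (transition j i y)
      * transitionJacobian j i y a b := fun b k => pd_transition (F.contMDiff_imm_coord k) hy b
  have hα : ∀ b, F.oneForm V i b y = F.oneForm V j 0 (transition j i y)
      * transitionJacobian j i y 0 b + F.oneForm V j 1 (transition j i y)
      * transitionJacobian j i y 1 b := by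
    intro b
    simp only [oneForm, h, Fin.sum_univ_two, symm_transition hy, Finset.sum_mul,
      ← Finset.sum_add_distrib]
    exact Finset.sum_congr rfl fun s _ => by ring
  simp only [wedge, hα, pd_transition hχ hy, Fin.sum_univ_two, Matrix.det_fin_two]
  ring

/-- The definition uses the chart centred at the point; the Jacobians of form and wedge cancel, so
any chart serves. -/
lemma exactDensity_symm (hχ : ContMDiff (𝓡 2) 𝓘(ℝ) ∞ χ) (hy : y ∈ (extChartAt (𝓡 2) i).target) :
    F.exactDensity V χ ((extChartAt (𝓡 2) i).symm y)
      = χ ((extChartAt (𝓡 2) i).symm y) * F.curlFlux V ((extChartAt (𝓡 2) i).symm y)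
        + F.wedge V χ i y / F.areaForm i y := by
  set a := (extChartAt (𝓡 2) i).symm y with ha
  have hy' : y ∈ transitionDom 2 a i := ⟨hy, mem_extChartAt_source a⟩
  have ht : extChartAt (𝓡 2) a a = transition a i y := rfl
  have ho := F.areaForm_ne_zero hy
  rw [F.areaForm_transition hy'] at ho
  rw [exactDensity, ht, F.areaForm_transition hy', F.wedge_transition hχ hy',
    mul_div_mul_left _ _ (left_ne_zero_of_mul ho)]

section Smooth

variable (hS : IsOpen S) (hV : ∀ s, ContDiffOn ℝ ∞ (V s) S)

include hV in
lemma contDiffOn_oneForm (i : A) (b : Fin 2) :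
    ContDiffOn ℝ ∞ (F.oneForm V i b) (extChartAt (𝓡 2) i).target :=
  ContDiffOn.sum fun s _ => ((hV s).comp (F.contDiffOn_imm_symm i) fun _ _ => F.imm_mem _).mul
    (contDiffOn_pd (isOpen_extChartAt_target i) (F.contDiffOn_chartMap i s) b)

include hS hV in
-- The exterior derivative commutes with pull-back: second derivatives of the immersion cancel, and
-- the minors of its Jacobian are the area form times the normal by `cross_pd`.
lemma pd_oneForm_sub (hy : y ∈ (extChartAt (𝓡 2) i).target) :
    pd 0 (F.oneForm V i 1) y - pd 1 (F.oneForm V i 0) y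
      = F.curlFlux V ((extChartAt (𝓡 2) i).symm y) * F.areaForm i y := by
  have ho : IsOpen (extChartAt (𝓡 2) i).target := isOpen_extChartAt_target i
  have hd1 : ∀ s, DifferentiableAt ℝ (V s) (F.imm ((extChartAt (𝓡 2) i).symm y)) := fun s =>
    ContDiffOn.diffAt hS (hV s) (F.imm_mem _)
  have hd2 : DifferentiableAt ℝ (fun w => F.imm ((extChartAt (𝓡 2) i).symm w)) y :=
    ContDiffOn.diffAt ho (F.contDiffOn_imm_symm i) hy
  have hd3 : ∀ s, DifferentiableAt ℝ (fun w => V s (F.imm ((extChartAt (𝓡 2) i).symm w))) y :=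
    fun s => (hd1 s).comp y hd2
  have hd4 : ∀ b s, DifferentiableAt ℝ (pd b (F.chartMap i s)) y := fun b s =>
    ContDiffOn.diffAt ho (contDiffOn_pd ho (F.contDiffOn_chartMap i s) b) hy
  have h1 : ∀ a b, pd a (F.oneForm V i b) y
      = ∑ s, ((∑ l, pd l (V s) (F.imm ((extChartAt (𝓡 2) i).symm y)) * pd a (F.chartMap i l) y)
          * pd b (F.chartMap i s) y
        + V s (F.imm ((extChartAt (𝓡 2) i).symm y)) * pd a (pd b (F.chartMap i s)) y) := by
    intro a b
    have e : F.oneForm V i b = fun w => ∑ s, V s (F.imm ((extChartAt (𝓡 2) i).symm w))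
      * pd b (F.chartMap i s) w := rfl
    rw [e, pd_sum (f := fun s w => V s (F.imm ((extChartAt (𝓡 2) i).symm w))
      * pd b (F.chartMap i s) w) _ _ fun s _ => (hd3 s).mul (hd4 b s)]
    refine Finset.sum_congr rfl fun s _ => ?_
    rw [pd_mul a (hd3 s) (hd4 b s), pd_comp (f := V s) a (hd1 s) hd2]
    rfl
  have h2 : ∀ s, pd 0 (pd 1 (F.chartMap i s)) y = pd 1 (pd 0 (F.chartMap i s)) y := fun s =>
    pd_comm ho (F.contDiffOn_chartMap i s) hy 0 1
  obtain ⟨c0, c1, c2⟩ := F.cross_pd hy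
  rw [h1, h1]
  simp only [h2, curlFlux, curl, Fin.sum_univ_three, leviCivita_three]
  generalize (extChartAt (𝓡 2) i).symm y = a at c0 c1 c2 ⊢
  generalize F.imm a = P
  simp
  linear_combination (pd 1 (V 2) P - pd 2 (V 1) P) * c0 + (pd 2 (V 0) P - pd 0 (V 2) P) * c1
    + (pd 0 (V 1) P - pd 1 (V 0) P) * c2

/-- The orientation of a chart relative to the normal field. -/
def chartSign (i : A) (y : E2) : ℝ := F.areaForm i y / |F.areaForm i y|

lemma abs_areaForm (hy : y ∈ (extChartAt (𝓡 2) i).target) :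
    |F.areaForm i y| = F.chartSign i y * F.areaForm i y := by
  have h := abs_ne_zero.2 (F.areaForm_ne_zero hy)
  rw [chartSign, div_mul_eq_mul_div, eq_div_iff h, abs_mul_abs_self]

/-- The area form is continuous without zeros, so its sign is locally constant; chart domains need
not be connected. -/
lemma chartSign_eventually_eq (hy : y ∈ (extChartAt (𝓡 2) i).target) :
    ∀ᶠ z in 𝓝 y, F.chartSign i z = F.chartSign i y := by
  have hc : ContinuousAt (F.areaForm i) y :=
    (F.continuousOn_areaForm i).continuousAt ((isOpen_extChartAt_target i).mem_nhds hy)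
  rcases lt_or_gt_of_ne (F.areaForm_ne_zero hy) with h | h
  · have e : ∀ z, F.areaForm i z < 0 → F.chartSign i z = -1 := fun z hz => by
      rw [chartSign, abs_of_neg hz, div_neg, div_self hz.ne]
    filter_upwards [hc.eventually_lt continuousAt_const h] with z hz
    rw [e z hz, e y h]
  · have e : ∀ z, 0 < F.areaForm i z → F.chartSign i z = 1 := fun z hz => by
      rw [chartSign, abs_of_pos hz, div_self hz.ne']
    filter_upwards [continuousAt_const.eventually_lt hc h] with z hz
    rw [e z hz, e y h]

include hS hV in
-- Leibniz' rule `d(χ α) = χ dα + dχ ∧ α` for the pulled-back form `α`; the chart sign converts the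
-- unsigned area density into the area form.
lemma exactDensity_mul_areaDensity (hχ : ContMDiff (𝓡 2) 𝓘(ℝ) ∞ χ)
    (hy : y ∈ (extChartAt (𝓡 2) i).target) :
    F.exactDensity V χ ((extChartAt (𝓡 2) i).symm y) * F.areaDensity i y
      = F.chartSign i y
        * (pd 0 (fun w => χ ((extChartAt (𝓡 2) i).symm w) * F.oneForm V i 1 w) y
          - pd 1 (fun w => χ ((extChartAt (𝓡 2) i).symm w) * F.oneForm V i 0 w) y) := by
  have ho : IsOpen (extChartAt (𝓡 2) i).target := isOpen_extChartAt_target i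
  have hd1 := ContDiffOn.diffAt ho (contDiffOn_comp_symm hχ i) hy
  have hd2 : ∀ b, DifferentiableAt ℝ (F.oneForm V i b) y := fun b =>
    ContDiffOn.diffAt ho (F.contDiffOn_oneForm hV i b) hy
  have h1 := F.pd_oneForm_sub hS hV hy
  have h2 := F.areaForm_ne_zero hy
  rw [F.exactDensity_symm hχ hy, F.areaDensity_eq hy, F.abs_areaForm hy, pd_mul 0 hd1 (hd2 1),
    pd_mul 1 hd1 (hd2 0)]
  have h3 : F.wedge V χ i y / F.areaForm i y * F.areaForm i y
      = pd 0 (fun w => χ ((extChartAt (𝓡 2) i).symm w)) y * F.oneForm V i 1 y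
    - pd 1 (fun w => χ ((extChartAt (𝓡 2) i).symm w)) y * F.oneForm V i 0 y :=
    div_mul_cancel₀ _ h2
  linear_combination F.chartSign i y * h3
    - F.chartSign i y * χ ((extChartAt (𝓡 2) i).symm y) * h1

include hS hV in
/-- Stokes' theorem in a chart. -/
lemma setIntegral_exactDensity (hχ : ContMDiff (𝓡 2) 𝓘(ℝ) ∞ χ)
    (hsupp : tsupport χ ⊆ (extChartAt (𝓡 2) i).source) :
    ∫ y in (extChartAt (𝓡 2) i).target,
      F.exactDensity V χ ((extChartAt (𝓡 2) i).symm y) * F.areaDensity i y = 0 := by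
  have ho : IsOpen (extChartAt (𝓡 2) i).target := isOpen_extChartAt_target i
  set T := (extChartAt (𝓡 2) i).target with hT
  set C := extChartAt (𝓡 2) i '' tsupport χ with hC
  have hCc : IsCompact C := isCompact_image_tsupport hsupp
  have hCT : C ⊆ T := by
    rintro _ ⟨a, ha, rfl⟩
    exact (extChartAt (𝓡 2) i).map_source (hsupp ha)
  set β : Fin 2 → E2 → ℝ := fun b w => χ ((extChartAt (𝓡 2) i).symm w) * F.oneForm V i b w with hβ
  have hβs : ∀ b, ContDiffOn ℝ ∞ (β b) T := fun b =>
    (contDiffOn_comp_symm hχ i).mul (F.contDiffOn_oneForm hV i b)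
  -- Extension by zero to the whole plane. It is differentiable because `χ` has compact support `C`
  -- inside the chart and the sign is locally constant, so its partial derivatives have integral
  -- zero.
  set Φ : Fin 2 → E2 → ℝ := fun b => T.indicator fun w => F.chartSign i w * β b w with hΦ
  have hΦ0 : ∀ b z, z ∉ C → Φ b z = 0 := by
    intro b z hz
    by_cases hzT : z ∈ T
    · simp only [hΦ, Set.indicator_of_mem hzT, hβ,
        image_eq_zero_of_notMem_tsupport (symm_notMem_tsupport hzT hz), zero_mul, mul_zero]
    · exact Set.indicator_of_notMem hzT _
  have hΦT : ∀ b z, z ∈ T → Φ b =ᶠ[𝓝 z] fun w => F.chartSign i z * β b w := by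
    intro b z hz
    filter_upwards [ho.mem_nhds hz, F.chartSign_eventually_eq hz] with w hw hs
    simp only [hΦ, Set.indicator_of_mem hw, hs]
  have hΦsm : ∀ b, ContDiff ℝ 1 (Φ b) := by
    intro b
    rw [contDiff_iff_contDiffAt]
    intro z
    by_cases hzT : z ∈ T
    · refine ContDiffAt.congr_of_eventuallyEq ?_ (hΦT b z hzT)
      exact contDiffAt_const.mul (((hβs b).contDiffAt (ho.mem_nhds hzT)).of_le (by norm_cast))
    · refine ContDiffAt.congr_of_eventuallyEq (contDiffAt_const (c := (0 : ℝ))) ?_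
      filter_upwards [hCc.isClosed.isOpen_compl.mem_nhds fun h => hzT (hCT h)] with w hw
      exact hΦ0 b w hw
  have hΦc : ∀ b, HasCompactSupport (Φ b) := fun b => HasCompactSupport.intro hCc (hΦ0 b)
  have hpd : ∀ a b z, z ∈ T → pd a (Φ b) z = F.chartSign i z * pd a (β b) z := by
    intro a b z hz
    rw [pd_congr a (hΦT b z hz),
      pd_mul a (differentiableAt_const _) (ContDiffOn.diffAt ho (hβs b) hz), pd_const]
    ring
  have hpd0 : ∀ a b z, z ∉ T → pd a (Φ b) z = 0 := by
    intro a b z hz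
    have : Φ b =ᶠ[𝓝 z] fun _ => (0 : ℝ) := by
      filter_upwards [hCc.isClosed.isOpen_compl.mem_nhds fun h => hz (hCT h)] with w hw
      exact hΦ0 b w hw
    rw [pd_congr a this, pd_const]
  calc ∫ y in T, F.exactDensity V χ ((extChartAt (𝓡 2) i).symm y) * F.areaDensity i y
      = ∫ y in T, (pd 0 (Φ 1) y - pd 1 (Φ 0) y) := by
        refine setIntegral_congr_fun ho.measurableSet fun y hy => ?_
        simp only [F.exactDensity_mul_areaDensity hS hV hχ hy, hpd _ _ y hy]
        ring
    _ = ∫ y, (pd 0 (Φ 1) y - pd 1 (Φ 0) y) :=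
        setIntegral_eq_integral_of_forall_compl_eq_zero fun y hy => by
          rw [hpd0 0 1 y hy, hpd0 1 0 y hy, sub_zero]
    _ = 0 := by
        rw [integral_sub (integrable_pd (hΦsm 1) (hΦc 1) 0) (integrable_pd (hΦsm 0) (hΦc 0) 1),
          integral_pd_eq_zero (hΦsm 1) (hΦc 1), integral_pd_eq_zero (hΦsm 0) (hΦc 0), sub_zero]

end Smooth

end ClosedSurface

/-! ### From charts to the whole surface by the partition of unity. -/

namespace ClosedSurface

variable {A : Type*} [TopologicalSpace A] [ChartedSpace E2 A] [IsManifold (𝓡 2) ∞ A] [T2Space A]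
  [CompactSpace A] {S : Set E3} (F : ClosedSurface S A) {i j : A} {V : Fin 3 → E3 → ℝ} {χ : A → ℝ}

variable (A) in
/-- The indices of the partition of unity whose members do not vanish identically. -/
def partitionIndex : Finset A :=
  ((partitionOfUnity A).locallyFinite.finite_nonempty_of_compact).toFinset

lemma partitionOfUnity_eq_zero {i : A} (hi : i ∉ partitionIndex A) (a : A) :
    partitionOfUnity A i a = 0 := by
  by_contra h
  exact hi ((Set.Finite.mem_toFinset _).2 ⟨a, h⟩)

lemma sum_partitionOfUnity (a : A) : ∑ i ∈ partitionIndex A, partitionOfUnity A i a = 1 := by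
  rw [← (partitionOfUnity A).sum_eq_one (Set.mem_univ a)]
  refine (finsum_eq_sum_of_support_subset _ fun i hi => ?_).symm
  by_contra h
  exact hi (partitionOfUnity_eq_zero h a)

lemma tsupport_partitionOfUnity (i : A) :
    tsupport (partitionOfUnity A i) ⊆ (extChartAt (𝓡 2) i).source := by
  rw [extChartAt_source]
  exact (SmoothPartitionOfUnity.exists_isSubordinate_chartAt_source (𝓡 2) A).choose_spec i

lemma integral_eq_sum (f : A → ℝ) : F.integral f = ∑ i ∈ partitionIndex A,
    ∫ y in (extChartAt (𝓡 2) i).target, partitionOfUnity A i ((extChartAt (𝓡 2) i).symm y)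
      * f ((extChartAt (𝓡 2) i).symm y) * F.areaDensity i y := by
  refine finsum_eq_sum_of_support_subset _ fun i hi => ?_
  by_contra h
  exact hi (by simp only [partitionOfUnity_eq_zero h, zero_mul, integral_zero])

lemma integrableOn_mul_areaDensity {k : A → ℝ} (hk : Continuous k)
    (hsupp : tsupport χ ⊆ (extChartAt (𝓡 2) i).source) (h0 : ∀ a ∉ tsupport χ, k a = 0) :
    IntegrableOn (fun y => k ((extChartAt (𝓡 2) i).symm y) * F.areaDensity i y)
      (extChartAt (𝓡 2) i).target := by
  have hC := isCompact_image_tsupport hsupp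
  have hCT : extChartAt (𝓡 2) i '' tsupport χ ⊆ (extChartAt (𝓡 2) i).target := by
    rintro _ ⟨a, ha, rfl⟩
    exact (extChartAt (𝓡 2) i).map_source (hsupp ha)
  have hc : ContinuousOn (fun y => k ((extChartAt (𝓡 2) i).symm y) * F.areaDensity i y)
      (extChartAt (𝓡 2) i).target :=
    (hk.comp_continuousOn (continuousOn_symm_extChartAt i)).mul
      ((F.continuousOn_areaForm i).abs.congr fun y hy => F.areaDensity_eq hy)
  refine ((hc.mono hCT).integrableOn_compact hC).of_forall_sdiff_eq_zero
    (isOpen_extChartAt_target i).measurableSet fun y hy => ?_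
  simp only [h0 _ (symm_notMem_tsupport hy.1 hy.2), zero_mul]

lemma integrableOn_partition {f : A → ℝ} (hf : Continuous f) (i : A) :
    IntegrableOn (fun y => partitionOfUnity A i ((extChartAt (𝓡 2) i).symm y)
      * f ((extChartAt (𝓡 2) i).symm y) * F.areaDensity i y) (extChartAt (𝓡 2) i).target :=
  F.integrableOn_mul_areaDensity (k := fun a => partitionOfUnity A i a * f a)
    ((partitionOfUnity A i).contMDiff.continuous.mul hf) (tsupport_partitionOfUnity i)
    fun a ha => by rw [image_eq_zero_of_notMem_tsupport ha, zero_mul]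

lemma integral_sub {f₁ f₂ : A → ℝ} (h₁ : Continuous f₁) (h₂ : Continuous f₂) :
    F.integral (fun a => f₁ a - f₂ a) = F.integral f₁ - F.integral f₂ := by
  simp only [integral_eq_sum, ← Finset.sum_sub_distrib]
  refine Finset.sum_congr rfl fun i _ => ?_
  rw [← MeasureTheory.integral_sub (F.integrableOn_partition h₁ i) (F.integrableOn_partition h₂ i)]
  exact integral_congr_ae (.of_forall fun y => by ring)

lemma integral_sum_finset {ι : Type*} (s : Finset ι) {f : ι → A → ℝ}
    (hf : ∀ j ∈ s, Continuous (f j)) :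
    F.integral (fun a => ∑ j ∈ s, f j a) = ∑ j ∈ s, F.integral (f j) := by
  simp only [integral_eq_sum]
  rw [Finset.sum_comm]
  refine Finset.sum_congr rfl fun i _ => ?_
  rw [← MeasureTheory.integral_finsetSum s fun j hj => F.integrableOn_partition (hf j hj) i]
  simp only [Finset.mul_sum, Finset.sum_mul]

/-- The integral of a function supported in one chart domain may be computed in that chart. -/
lemma integral_eq_setIntegral {h : A → ℝ} (hc : Continuous h)
    (hsupp : tsupport χ ⊆ (extChartAt (𝓡 2) j).source) (h0 : ∀ a ∉ tsupport χ, h a = 0) :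
    F.integral h = ∫ y in (extChartAt (𝓡 2) j).target,
      h ((extChartAt (𝓡 2) j).symm y) * F.areaDensity j y := by
  have h1 : ∀ i, ∫ y in (extChartAt (𝓡 2) i).target,
      partitionOfUnity A i ((extChartAt (𝓡 2) i).symm y)
        * h ((extChartAt (𝓡 2) i).symm y) * F.areaDensity i y
      = ∫ y in (extChartAt (𝓡 2) j).target, partitionOfUnity A i ((extChartAt (𝓡 2) j).symm y)
        * h ((extChartAt (𝓡 2) j).symm y) * F.areaDensity j y := by
    intro i
    -- The product of a partition member and `h` is supported in the domains of both charts, so it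
    -- can be integrated in chart `j` in place of chart `i`.
    refine setIntegral_transition (fun y hy hn => ?_) (fun y hy hn => ?_) fun y hy => ?_
    · rw [h0 _ fun hs => hn ⟨hy, hsupp hs⟩, mul_zero, zero_mul]
    · rw [image_eq_zero_of_notMem_tsupport fun hs => hn ⟨hy, tsupport_partitionOfUnity i hs⟩,
        zero_mul, zero_mul]
    · rw [symm_transition hy, F.areaDensity_eq hy.1, F.areaDensity_eq (transition_mem hy).1,
        F.areaForm_transition hy, abs_mul]
      ring
  have h2 : ∀ i ∈ partitionIndex A,
      IntegrableOn (fun y => partitionOfUnity A i ((extChartAt (𝓡 2) j).symm y)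
        * h ((extChartAt (𝓡 2) j).symm y) * F.areaDensity j y) (extChartAt (𝓡 2) j).target :=
    fun i _ => F.integrableOn_mul_areaDensity (k := fun a => partitionOfUnity A i a * h a)
      ((partitionOfUnity A i).contMDiff.continuous.mul hc) hsupp
      fun a ha => by rw [h0 a ha, mul_zero]
  simp only [integral_eq_sum, h1]
  rw [← MeasureTheory.integral_finsetSum _ h2]
  simp only [← Finset.sum_mul, sum_partitionOfUnity, one_mul]

lemma exactDensity_eq_zero {a : A} (ha : a ∉ tsupport χ) : F.exactDensity V χ a = 0 := by
  have h1 : ∀ᶠ y in 𝓝 (extChartAt (𝓡 2) a a), χ ((extChartAt (𝓡 2) a).symm y) = 0 := by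
    have hc : ContinuousAt (extChartAt (𝓡 2) a).symm (extChartAt (𝓡 2) a a) :=
      continuousAt_extChartAt_symm a
    have hn : (tsupport χ)ᶜ ∈ 𝓝 ((extChartAt (𝓡 2) a).symm (extChartAt (𝓡 2) a a)) := by
      rw [extChartAt_to_inv]
      exact (isClosed_tsupport χ).isOpen_compl.mem_nhds ha
    filter_upwards [hc.preimage_mem_nhds hn] with y hy
    exact image_eq_zero_of_notMem_tsupport hy
  have h2 : ∀ b, pd b (fun w => χ ((extChartAt (𝓡 2) a).symm w)) (extChartAt (𝓡 2) a a) = 0 :=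
    fun b => (pd_congr b (g := fun _ => 0) h1).trans (pd_const b 0)
  rw [exactDensity, wedge, h2, h2, image_eq_zero_of_notMem_tsupport ha]
  simp

/-- The members add up to one, so their differentials add up to zero and the wedge terms disappear.
-/
lemma sum_exactDensity (a : A) :
    ∑ j ∈ partitionIndex A, F.exactDensity V (partitionOfUnity A j) a = F.curlFlux V a := by
  have hd : ∀ j, DifferentiableAt ℝ (fun w => partitionOfUnity A j ((extChartAt (𝓡 2) a).symm w))
      (extChartAt (𝓡 2) a a) := fun j =>
    ContDiffOn.diffAt (isOpen_extChartAt_target a)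
      (contDiffOn_comp_symm (partitionOfUnity A j).contMDiff a) (mem_extChartAt_target a)
  have h1 : ∀ b, ∑ j ∈ partitionIndex A,
      pd b (fun w => partitionOfUnity A j ((extChartAt (𝓡 2) a).symm w))
        (extChartAt (𝓡 2) a a) = 0 := by
    intro b
    rw [← pd_sum _ b fun j _ => hd j]
    simp only [sum_partitionOfUnity, pd_const]
  simp only [exactDensity, wedge, Finset.sum_add_distrib, ← Finset.sum_mul, sum_partitionOfUnity,
    ← Finset.sum_div, Finset.sum_sub_distrib, h1, zero_mul, sub_zero, zero_div, add_zero, one_mul]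

section Smooth

variable (hS : IsOpen S) (hV : ∀ s, ContDiffOn ℝ ∞ (V s) S)
include hS hV

lemma continuous_curlFlux : Continuous (F.curlFlux V) := by
  have h1 : ∀ k, ContinuousOn (curl V k) S := fun k =>
    continuousOn_finsetSum _ fun l _ => continuousOn_finsetSum _ fun s _ =>
      continuousOn_const.mul (contDiffOn_pd hS (hV s) l).continuousOn
  exact continuous_finsetSum _ fun k _ =>
    ((h1 k).comp_continuous F.contMDiff_imm.continuous F.imm_mem).mul
      ((contDiff_coord k).continuous.comp F.continuous_normal)

/-- Near `a` the chart at `a` is used throughout, in place of the chart that moves with the point.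
-/
lemma continuous_exactDensity (hχ : ContMDiff (𝓡 2) 𝓘(ℝ) ∞ χ) :
    Continuous (F.exactDensity V χ) := by
  rw [continuous_iff_continuousAt]
  intro a
  have ho : IsOpen (extChartAt (𝓡 2) a).target := isOpen_extChartAt_target a
  have hα : ∀ b, ContinuousOn (F.oneForm V a b) (extChartAt (𝓡 2) a).target := fun b =>
    (F.contDiffOn_oneForm hV a b).continuousOn
  have hp : ∀ b, ContinuousOn (pd b fun w => χ ((extChartAt (𝓡 2) a).symm w))
      (extChartAt (𝓡 2) a).target := fun b =>
    (contDiffOn_pd ho (contDiffOn_comp_symm hχ a) b).continuousOn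
  have h1 : ContinuousOn (fun y => F.wedge V χ a y / F.areaForm a y)
      (extChartAt (𝓡 2) a).target :=
    (((hp 0).mul (hα 1)).sub ((hp 1).mul (hα 0))).div (F.continuousOn_areaForm a)
      fun y hy => F.areaForm_ne_zero hy
  have h2 : ContinuousOn (fun b => χ b * F.curlFlux V b
      + F.wedge V χ a (extChartAt (𝓡 2) a b) / F.areaForm a (extChartAt (𝓡 2) a b))
      (extChartAt (𝓡 2) a).source :=
    (hχ.continuous.mul (F.continuous_curlFlux hS hV)).continuousOn.add
      (h1.comp (continuousOn_extChartAt a) (extChartAt (𝓡 2) a).mapsTo)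
  have hn : (extChartAt (𝓡 2) a).source ∈ 𝓝 a := extChartAt_source_mem_nhds a
  refine (h2.continuousAt hn).congr ?_
  filter_upwards [hn] with b hb
  have h3 := F.exactDensity_symm (V := V) hχ ((extChartAt (𝓡 2) a).map_source hb)
  rw [(extChartAt (𝓡 2) a).left_inv hb] at h3
  exact h3.symm

/-- Stokes' theorem: the flux of a curl through a closed surface vanishes. -/
theorem integral_curlFlux : F.integral (F.curlFlux V) = 0 := by
  have hsm : ∀ j : A, ContMDiff (𝓡 2) 𝓘(ℝ) ∞ (partitionOfUnity A j) := fun j =>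
    (partitionOfUnity A j).contMDiff
  have h1 : F.curlFlux V
      = fun a => ∑ j ∈ partitionIndex A, F.exactDensity V (partitionOfUnity A j) a :=
    funext fun a => (F.sum_exactDensity a).symm
  rw [h1, F.integral_sum_finset _ fun j _ => F.continuous_exactDensity hS hV (hsm j)]
  refine Finset.sum_eq_zero fun j _ => ?_
  rw [F.integral_eq_setIntegral (F.continuous_exactDensity hS hV (hsm j))
    (tsupport_partitionOfUnity j) fun a ha => F.exactDensity_eq_zero ha]
  exact F.setIntegral_exactDensity hS hV (hsm j) (tsupport_partitionOfUnity j)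

end Smooth

end ClosedSurface

/-! ### Continuity of the momentum flux, and the conclusion. -/

lemma continuous_rotationGenerator (k j : Fin 3) :
    Continuous fun z => rotationGenerator k z j :=
  continuous_finsetSum _ fun i _ => continuous_const.mul (contDiff_coord i).continuous

lemma FlatHypersurface.continuousOn_momentum {M : Type*} [TopologicalSpace M] [ChartedSpace E4 M]
    [IsManifold (𝓡 4) ∞ M] {g : LorentzMetric M} (H : FlatHypersurface g) (i j : Fin 3) :
    ContinuousOn (fun z => H.momentum z i j) H.dom := by
  have h := fun a b => (H.contDiffOn_extrinsic a b).continuousOn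
  simp only [momentum, Matrix.add_apply, Matrix.neg_apply, Matrix.smul_apply, smul_eq_mul,
    Matrix.trace, Matrix.diag_apply]
  exact (h i j).neg.add ((continuousOn_finsetSum _ fun a _ => h a a).mul continuousOn_const)

end FlatCharge

end

theorem theorem4p2 {M : Type*} [TopologicalSpace M] [ChartedSpace FlatCharge.E4 M]
    [IsManifold (𝓡 4) ∞ M]
    (g : FlatCharge.LorentzMetric M) (Λ : ℝ) (hvac : FlatCharge.IsVacuum g Λ)
    (H : FlatCharge.FlatHypersurface g) (hdiv : H.MagneticDivergenceFree)
    {A : Type*} [TopologicalSpace A] [ChartedSpace FlatCharge.E2 A] [IsManifold (𝓡 2) ∞ A]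
    [T2Space A] [CompactSpace A] (F : FlatCharge.ClosedSurface H.dom A)
    (hT : ∀ l : Fin 3, F.charge H.magnetic (FlatCharge.translationGenerator l) = 0) (k : Fin 3) :
    F.charge H.magnetic (FlatCharge.properConformalGenerator k)
      = F.charge H.momentum (FlatCharge.rotationGenerator k) := by
  open FlatCharge in
  have hV := H.contDiffOn_extrinsicContract (contDiff_properConformalGenerator k)
  have hP : Continuous fun a => ∑ i, ∑ j,
      H.momentum (F.imm a) i j * rotationGenerator k (F.imm a) j * F.normal a i :=
    continuous_finsetSum _ fun i _ => continuous_finsetSum _ fun j _ =>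
      (((H.continuousOn_momentum i j).comp_continuous F.contMDiff_imm.continuous F.imm_mem).mul
        ((continuous_rotationGenerator k j).comp F.contMDiff_imm.continuous)).mul
        ((contDiff_coord i).continuous.comp F.continuous_normal)
  -- `magnetic_contract_eq` contracted with the unit normal: the two flux densities differ by the
  -- flux of a curl.
  have hflux : (fun a => ∑ i, ∑ j, H.magnetic (F.imm a) i j
        * properConformalGenerator k (F.imm a) j * F.normal a i)
      = fun a => (∑ i, ∑ j, H.momentum (F.imm a) i j * rotationGenerator k (F.imm a) j
          * F.normal a i)
        - F.curlFlux (H.extrinsicContract (properConformalGenerator k)) a := by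
    ext a
    simp only [← Finset.sum_mul, H.magnetic_contract_eq hvac (F.imm_mem a), sub_mul,
      Finset.sum_sub_distrib, ClosedSurface.curlFlux]
  rw [ClosedSurface.charge, hflux,
    F.integral_sub hP (F.continuous_curlFlux H.isOpen_dom hV),
    F.integral_curlFlux H.isOpen_dom hV, sub_zero, ClosedSurface.charge]
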